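/- **Setting.** For $\delta>0$ let $L_\delta$ be the lattice of closed cubes $\prod_a[\delta z_a,\delta(z_a+1)]$, $z\in\mathbb Z^p$, of $\mathbb R^p$. Let $S_i(x)=c\,A_ix+t_i$, $i\in I$, be finitely many similarity transforms of $\mathbb R^p$ ($A_i$ linear isometries) with a common contraction factor $c\in(0,1)$, which map the open unit cube $(0,1)^p$ onto the interiors of pairwise different cubes of $L_c$ lying in $[0,1]^p$. Let $M\subset\mathbb R^p$ be a strictly self-similar set, i.e. non-empty, bounded, with $M=\bigcup_{i\in I}S_i(M)$. For $n\ge 0$ let $\mathcal G_n$ be the graph whose nodes are the cubes of $L_{c^n}$ whose interior meets $M$ (if $M\subset(0,1)^p$, e.g. if $M=\bigcap_n\bigcup_{|w|=n}S_w((0,1)^p)$ is generated with the open unit cube, these are exactly the closed cubes that meet $M$), two different cubes being joined by a bond iff they have a common point; $\mathcal G_1$ is the generator. For a word $w=w_1\cdots w_n$ put $S_w=S_{w_1}\circ\dots\circ S_{w_n}$. Assume that $\mathcal G_{n+1}$ arises from $\mathcal G_n$ by replacing each node by a copy of $\mathcal G_1$ and interpreting the bonds of $\mathcal G_n$ as bonds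 between nodes of the copies: for every bond $QQ'$ of $\mathcal G_n$ there is a bond of $\mathcal G_{n+1}$ between a cube contained in $Q$ and a cube contained in $Q'$. A node $S_i([0,1]^p)$ of $\mathcal G_1$ is called marginal if it carries outer bonds: there are words $w\ne w'$ of equal length and $j\in I$ such that $S_wS_i([0,1]^p)$ and $S_{w'}S_j([0,1]^p)$ have a common point. For $x_0=S_{i_0}([0,1]^p)$, the adjoint self-similar graph $\mathcal G_\infty$ is the union of the graphs $\mathcal G_n$, each embedded in $\mathcal G_{n+1}$ as the copy with index $i_0$; explicitly its nodes are the cubes of $L_1$ whose interior meets $\bigcup_nS_{i_0}^{-n}(M)$, with bonds between different cubes having a common point. A graph has internal scaling dimension $D$ if for each node $x$ all balls $U_n(x)$ of the graph metric are finite and $\lim_{n\to\infty}\ln|U_n(x)|/\ln n=D$. The box-counting dimension of $M$ is $\dim_B M=\lim_{\delta\to0}\ln N_\delta/(-\ln\delta)$, where $N_\delta$ is the number of cubes of $L_\delta$ that meet $M$. **Theorem.** 1. Suppose that there are $r\in\mathbb N$ with $2r+1=1/c$ and a node $x_0=S_{i_0}([0,1]^p)$ of $\mathcal G_1$ such that all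 marginal nodes of $\mathcal G_1$ have distance $r$ to $x_0$ in $\mathcal G_1$, and that $\mathcal G_\infty$ is connected. Then the internal scaling dimension of $\mathcal G_\infty$ and the box-counting dimension of $M$ both exist, and they are equal. 2. For $l\ge1$ consider the sponge-type generator given by the $2l^2+2l+1$ similarities $S_q(x)=\frac{1}{2l+1}(x+q)$ of $\mathbb R^2$, with $q\in\{0,\dots,2l\}^2$ and $q_1+q_2$ even (for $l=1$ the Maltese cross), with the central cell $q=(l,l)$ as $x_0$. The set generated by it with the open unit square is strictly self-similar, and for every strictly self-similar set of these similarities the graph $\mathcal G_\infty$ has internal scaling dimension $$D_S^{(l)}=\frac{\ln(2l^2+2l+1)}{\ln(2l+1)} .$$ 3. $\lim_{l\to\infty}D_S^{(l)}=2$. -/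

import Mathlib

open Filter Topology

noncomputable section

namespace SelfSimilarGraph

/-! ### Dimensions of graphs and of sets -/

/-- The `n`-neighborhood of a node `x`: all nodes at graph distance at most `n` from `x`. -/
def neighborhood {V : Type*} (G : SimpleGraph V) (n : ℕ) (x : V) : Set V :=
  {y | G.edist x y ≤ (n : ℕ∞)}

/-- `G` has internal scaling dimension `D`: starting from every node `x`, all neighborhoods
`U_n(x)` are finite and `ln |U_n(x)| / ln n` converges to `D`. -/
def HasInternalScalingDimension {V : Type*} (G : SimpleGraph V) (D : ℝ) : Prop :=
  ∀ x : V, (∀ n : ℕ, (neighborhood G n x).Finite) ∧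
    Tendsto (fun n : ℕ => Real.log ((neighborhood G n x).ncard : ℝ) / Real.log (n : ℝ))
      atTop (𝓝 D)

/-- The closed cube with index `z` of the cubic lattice of edge length `δ` in `ℝ^p`. -/
def closedCube {p : ℕ} (δ : ℝ) (z : Fin p → ℤ) : Set (EuclideanSpace ℝ (Fin p)) :=
  {x | ∀ a, δ * (z a : ℝ) ≤ x a ∧ x a ≤ δ * ((z a : ℝ) + 1)}

/-- The interior of `closedCube δ z`. -/
def openCube {p : ℕ} (δ : ℝ) (z : Fin p → ℤ) : Set (EuclideanSpace ℝ (Fin p)) :=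
  {x | ∀ a, δ * (z a : ℝ) < x a ∧ x a < δ * ((z a : ℝ) + 1)}

/-- The number of closed cubes of the cubic lattice of edge length `δ` that intersect `M`. -/
def boxCount {p : ℕ} (δ : ℝ) (M : Set (EuclideanSpace ℝ (Fin p))) : ℕ :=
  {z : Fin p → ℤ | (closedCube δ z ∩ M).Nonempty}.ncard

/-- The bounded set `M` has box-counting dimension `D`. -/
def HasBoxDimension {p : ℕ} (M : Set (EuclideanSpace ℝ (Fin p))) (D : ℝ) : Prop :=
  Bornology.IsBounded M ∧
    Tendsto (fun δ : ℝ => Real.log (boxCount δ M : ℝ) / (-Real.log δ)) (𝓝[>] 0) (𝓝 D)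

/-! ### Self-similar sets -/

/-- A family of similarity transforms `S_i : x ↦ c • A_i x + t_i` of `ℝ^p`, with `A_i` a linear
isometry and with the common factor `c`. -/
structure SimilaritySystem (p : ℕ) (ι : Type*) where
  ratio : ℝ
  linear : ι → (EuclideanSpace ℝ (Fin p) ≃ₗᵢ[ℝ] EuclideanSpace ℝ (Fin p))
  shift : ι → EuclideanSpace ℝ (Fin p)

namespace SimilaritySystem

variable {p : ℕ} {ι : Type*}

/-- The similarity transform `S_i`. -/
def map (S : SimilaritySystem p ι) (i : ι) (x : EuclideanSpace ℝ (Fin p)) :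
    EuclideanSpace ℝ (Fin p) :=
  S.ratio • S.linear i x + S.shift i

/-- `S_w = S_{w_1} ∘ ⋯ ∘ S_{w_n}` for a word `w = w_1 ⋯ w_n`. -/
def wordMap (S : SimilaritySystem p ι) :
    List ι → EuclideanSpace ℝ (Fin p) → EuclideanSpace ℝ (Fin p)
  | [] => id
  | i :: w => S.map i ∘ S.wordMap w

/-- `M` is a (non-empty, bounded) strictly self-similar set: `M = ⋃ i, S_i(M)`. Compactness is
not required, so that also the set generated by the open unit cube qualifies. -/
def IsSelfSimilarSet (S : SimilaritySystem p ι) (M : Set (EuclideanSpace ℝ (Fin p))) : Prop :=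
  M.Nonempty ∧ Bornology.IsBounded M ∧ M = ⋃ i, S.map i '' M

/-- The set generated with the open unit cube: the intersection of all construction steps. -/
def generatedSet (S : SimilaritySystem p ι) : Set (EuclideanSpace ℝ (Fin p)) :=
  ⋂ n : ℕ, ⋃ w ∈ {w : List ι | w.length = n}, S.wordMap w '' openCube 1 0

/-- The similarities fit to the cubic lattices: they map the open unit cube onto the interiors of
pairwise different cubes of the lattice of edge length `c`, all inside the unit cube. -/
def FitsLattice (S : SimilaritySystem p ι) : Prop :=
  (∀ i, ∃ z : Fin p → ℤ, S.map i '' openCube 1 0 = openCube S.ratio z ∧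
    openCube S.ratio z ⊆ openCube 1 0) ∧
  Pairwise fun i j => Disjoint (S.map i '' openCube 1 0) (S.map j '' openCube 1 0)

end SimilaritySystem

/-! ### The adjoint graphs -/

/-- The nodes of the covering graph of `M` at scale `δ`: the lattice cubes of edge length `δ`
whose interior meets `M`, so that cubes which `M` merely touches from outside are not counted.
(If `M` is generated with the open unit cube by similarities that fit the lattices, then at the
scales `δ = c ^ n` these are exactly the closed lattice cubes that intersect `M`.) -/
abbrev CoverNode {p : ℕ} (δ : ℝ) (M : Set (EuclideanSpace ℝ (Fin p))) : Type :=
  {z : Fin p → ℤ // (openCube δ z ∩ M).Nonempty}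

/-- Two different cubes are connected by a bond iff the closed cubes intersect. -/
def coverGraph {p : ℕ} (δ : ℝ) (M : Set (EuclideanSpace ℝ (Fin p))) :
    SimpleGraph (CoverNode δ M) where
  Adj u v := u ≠ v ∧ (closedCube δ u.1 ∩ closedCube δ v.1).Nonempty
  symm := ⟨fun _ _ h => ⟨h.1.symm, by rw [Set.inter_comm]; exact h.2⟩⟩
  loopless := ⟨fun _ h => h.1 rfl⟩

namespace SimilaritySystem

variable {p : ℕ} {ι : Type*}

/-- The nodes of the graph `G_n` of the `n`-th construction step. -/
abbrev StepNode (S : SimilaritySystem p ι) (M : Set (EuclideanSpace ℝ (Fin p))) (n : ℕ) : Type :=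
  CoverNode (S.ratio ^ n) M

/-- The graph `G_n` of the `n`-th construction step: the covering of `M` by cubes of edge length
`c ^ n`. In particular `G_1` is the generator. -/
abbrev stepGraph (S : SimilaritySystem p ι) (M : Set (EuclideanSpace ℝ (Fin p))) (n : ℕ) :
    SimpleGraph (S.StepNode M n) :=
  coverGraph (S.ratio ^ n) M

/-- The blow-up `⋃ n, S_i^{-n}(M)` of `M`, an increasing union. -/
def blowUp (S : SimilaritySystem p ι) (i : ι) (M : Set (EuclideanSpace ℝ (Fin p))) :
    Set (EuclideanSpace ℝ (Fin p)) :=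
  ⋃ n : ℕ, (S.map i)^[n] ⁻¹' M

/-- The infinite adjoint graph `G_∞`, obtained by infinite continuation of the construction: each
`G_n` sits in `G_{n+1}` as the copy of index `i`. Rescaling `G_n` by `S_i^{-n}` turns its cubes
into unit cubes, and `G_∞` is the union: the unit cubes that cover `⋃ n, S_i^{-n}(M)`. -/
abbrev adjointGraph (S : SimilaritySystem p ι) (i : ι) (M : Set (EuclideanSpace ℝ (Fin p))) :
    SimpleGraph (CoverNode 1 (S.blowUp i M)) :=
  coverGraph 1 (S.blowUp i M)

/-- The node `v` of the generator `G_1` is the cube of the similarity `S_i`. -/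
def IsNodeOf (S : SimilaritySystem p ι) (M : Set (EuclideanSpace ℝ (Fin p)))
    (v : S.StepNode M 1) (i : ι) : Prop :=
  S.map i '' openCube 1 0 = openCube (S.ratio ^ 1) v.1

/-- The node `v` of the generator is marginal, i.e. carries outer bonds: in some step the node
corresponding to `v` in some copy `w` of the generator has a bond to another copy `w'`. -/
def IsMarginal (S : SimilaritySystem p ι) (M : Set (EuclideanSpace ℝ (Fin p)))
    (v : S.StepNode M 1) : Prop :=
  ∃ i, S.IsNodeOf M v i ∧ ∃ w w' : List ι, w.length = w'.length ∧ w ≠ w' ∧ ∃ j,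
    (S.wordMap w '' (S.map i '' closedCube 1 0) ∩
      S.wordMap w' '' (S.map j '' closedCube 1 0)).Nonempty

/-- The covering construction and the construction by insertion match: when the nodes of `G_n` are
replaced by copies of the generator, every bond of `G_n` is a bond of `G_{n+1}` between nodes of the
two copies which replace its end nodes. -/
def BondsAreInherited (S : SimilaritySystem p ι) (M : Set (EuclideanSpace ℝ (Fin p))) : Prop :=
  ∀ (n : ℕ) (u v : S.StepNode M n), (S.stepGraph M n).Adj u v →
    ∃ u' v' : S.StepNode M (n + 1),
      openCube (S.ratio ^ (n + 1)) u'.1 ⊆ openCube (S.ratio ^ n) u.1 ∧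
      openCube (S.ratio ^ (n + 1)) v'.1 ⊆ openCube (S.ratio ^ n) v.1 ∧
      (S.stepGraph M (n + 1)).Adj u' v'

end SimilaritySystem

/-! ### The sponges -/

/-- The cells of the `l`-th sponge generator: the checkerboard pattern in the
`(2l+1) × (2l+1)` square that contains the corners. -/
abbrev SpongeIndex (l : ℕ) : Type :=
  {q : Fin (2 * l + 1) × Fin (2 * l + 1) // Even ((q.1 : ℕ) + (q.2 : ℕ))}

/-- The similarities `x ↦ (x + q) / (2l+1)`; for `l = 1` they generate the Maltese cross. -/
def spongeSystem (l : ℕ) : SimilaritySystem 2 (SpongeIndex l) where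
  ratio := 1 / (2 * (l : ℝ) + 1)
  linear _ := LinearIsometryEquiv.refl ℝ _
  shift q := (1 / (2 * (l : ℝ) + 1)) • !₂[((q.1.1 : ℕ) : ℝ), ((q.1.2 : ℕ) : ℝ)]

/-- The central cell of the `l`-th sponge generator. -/
def spongeCenter (l : ℕ) : SpongeIndex l :=
  ⟨(⟨l, by omega⟩, ⟨l, by omega⟩), ⟨l, rfl⟩⟩

end SelfSimilarGraph

end

open Filter Topology

noncomputable section

namespace SelfSimilarGraph

/-! ### Lattice cubes -/

/-! Write `N = Nat.card ι` and `m = 1 / c = 2 r + 1`. Both dimensions in part 1 equal `ln N / ln m`,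
because the box counts and the ball sizes are both comparable, up to constant factors, with `N ^ j`
at scale `m ^ j`.

The common language is that of words (`IsCoding`, `exists_isCoding`). Isometries that fit the
lattices are signed permutations of the coordinates, so each `S_w` acts on lattice indices by a
bijection `E w`. The cubes of edge `c ^ n` whose interior meets `M` are then coded injectively by
the `N ^ n` words of length `n`. Comparing lattices of different edge lengths costs a factor `3 ^
p`, which gives the box dimension (`hasBoxDimension`).

Balls cannot be too large (`ncard_neighborhood_le`): a bond changes every lattice coordinate by at
most one. A ball of radius at most `m ^ j` therefore meets at most `3 ^ p` blocks of side `m ^ j`,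
each with `N ^ j` nodes.

Balls cannot be too small (`le_ncard_neighborhood`): this is where the condition on marginal nodes
enters. A bond between two copies of the generator joins marginal nodes, so it yields a path of
length `r + 1 + r = m` between the cells `i₀` of these copies (`mem_neighborhood_append`). Distances
thus grow at most by the factor `m` per step, and all `N ^ j` nodes of step `j` lie within `d * m ^
j` of the base node. The finite `d` exists because connectedness of the infinite graph forces the
generator to be connected (`reachable_of_adjointGraph`).

For the sponges, inherited bonds run between facing corner cells, and diagonal moves reach the
centre from any cell in at most `l` steps, so the same growth theorem applies. The limit follows
from `(2l+1)² / 2 ≤ 2l² + 2l + 1 ≤ (2l+1)²`. -/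

theorem openCube_subset_closedCube {p : ℕ} (δ : ℝ) (z : Fin p → ℤ) :
    openCube δ z ⊆ closedCube δ z := fun _ hx a => ⟨(hx a).1.le, (hx a).2.le⟩

theorem closedCube_inter_nonempty_iff {p : ℕ} {δ : ℝ} (hδ : 0 < δ) (z z' : Fin p → ℤ) :
    (closedCube δ z ∩ closedCube δ z').Nonempty ↔ ∀ a, |z a - z' a| ≤ 1 := by
  constructor
  · rintro ⟨x, hx, hx'⟩ a
    have h1 := le_of_mul_le_mul_left ((hx a).1.trans (hx' a).2) hδ
    have h2 := le_of_mul_le_mul_left ((hx' a).1.trans (hx a).2) hδ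
    have h1' : z a ≤ z' a + 1 := by exact_mod_cast h1
    have h2' : z' a ≤ z a + 1 := by exact_mod_cast h2
    rw [abs_le]; constructor <;> linarith
  · intro h
    refine ⟨WithLp.toLp 2 fun a => δ * ((max (z a) (z' a) : ℤ) : ℝ), fun a => ?_, fun a => ?_⟩
    all_goals
      have := abs_le.1 (h a)
      refine ⟨mul_le_mul_of_nonneg_left (Int.cast_le.2 (by omega)) hδ.le,
        mul_le_mul_of_nonneg_left ?_ hδ.le⟩
      rw [← Int.cast_one, ← Int.cast_add]
      exact Int.cast_le.2 (by omega)

theorem eq_of_openCube_inter_closedCube {p : ℕ} {δ : ℝ} (hδ : 0 < δ) {z z' : Fin p → ℤ}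
    {x : EuclideanSpace ℝ (Fin p)} (hx : x ∈ openCube δ z) (hx' : x ∈ closedCube δ z') :
    z = z' := by
  funext a
  have h1 := lt_of_mul_lt_mul_left ((hx a).1.trans_le (hx' a).2) hδ.le
  have h2 := lt_of_mul_lt_mul_left ((hx' a).1.trans_lt (hx a).2) hδ.le
  have h1' : z a < z' a + 1 := by exact_mod_cast h1
  have h2' : z' a < z a + 1 := by exact_mod_cast h2
  omega

/-- The center of the unit cube. -/
def cubeCenter (p : ℕ) : EuclideanSpace ℝ (Fin p) := WithLp.toLp 2 fun _ => 1 / 2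

theorem cubeCenter_mem (p : ℕ) : cubeCenter p ∈ openCube 1 (0 : Fin p → ℤ) := by
  intro a; norm_num [cubeCenter]

theorem openCube_nonempty {p : ℕ} {δ : ℝ} (hδ : 0 < δ) (z : Fin p → ℤ) :
    (openCube δ z).Nonempty := by
  refine ⟨WithLp.toLp 2 fun a => δ * ((z a : ℝ) + 1 / 2), fun a => ⟨?_, ?_⟩⟩ <;>
    exact mul_lt_mul_of_pos_left (by linarith) hδ

theorem openCube_inj {p : ℕ} {δ : ℝ} (hδ : 0 < δ) {z z' : Fin p → ℤ}
    (h : openCube δ z ⊆ openCube δ z') : z = z' := by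
  obtain ⟨x, hx⟩ := openCube_nonempty hδ z
  exact eq_of_openCube_inter_closedCube hδ hx (openCube_subset_closedCube _ _ (h hx))

theorem eq_ediv_of_openCube_inter {p : ℕ} {δ : ℝ} (hδ : 0 < δ) {k : ℕ} (hk : 0 < k)
    {z z' : Fin p → ℤ} {x : EuclideanSpace ℝ (Fin p)} (hx : x ∈ openCube δ z)
    (hx' : x ∈ openCube (δ * k) z') (a : Fin p) : z' a = z a / k := by
  have hk' : (0 : ℤ) < k := by exact_mod_cast hk
  have h1 : δ * (z a : ℝ) < δ * (k * ((z' a : ℝ) + 1)) := by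
    rw [← mul_assoc]; exact (hx a).1.trans (hx' a).2
  have h2 : δ * (k * (z' a : ℝ)) < δ * ((z a : ℝ) + 1) := by
    rw [← mul_assoc]; exact (hx' a).1.trans (hx a).2
  have h1' : z a < k * (z' a + 1) := by exact_mod_cast lt_of_mul_lt_mul_left h1 hδ.le
  have h2' : k * z' a < z a + 1 := by exact_mod_cast lt_of_mul_lt_mul_left h2 hδ.le
  symm
  rw [Int.ediv_eq_iff_of_pos hk']
  constructor <;> nlinarith

/-! ### Isometries that preserve the lattices -/

/-- Let `v` be the preimage of the basis vector `e_b`. It has Euclidean norm 1, but some coordinate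
of modulus at least 1, since otherwise its image `e_b` would lie in the open sup-norm ball. Hence `v
= ± e_a`, and the coordinate `b` of `A x` is the inner product of `v` and `x`. -/
theorem exists_signedPerm {p : ℕ}
    (A : EuclideanSpace ℝ (Fin p) ≃ₗᵢ[ℝ] EuclideanSpace ℝ (Fin p))
    (hA : ∀ x, (∀ a, |x a| < 1) → ∀ a, |A x a| < 1) :
    ∃ (τ : Equiv.Perm (Fin p)) (s : Fin p → ℤ), (∀ b, s b = 1 ∨ s b = -1) ∧
      ∀ x b, A x b = s b * x (τ b) := by
  have key : ∀ b, ∃ (a : Fin p) (s : ℤ), (s = 1 ∨ s = -1) ∧ ∀ x, A x b = s * x a := by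
    intro b
    set v := A.symm (EuclideanSpace.single b (1 : ℝ)) with hv
    have hAv : A v = EuclideanSpace.single b (1 : ℝ) := by simp [hv]
    have hnorm : ∑ a, v a ^ 2 = 1 := by
      have h : ‖v‖ = 1 := by simp [hv]
      have h2 := EuclideanSpace.norm_sq_eq v
      rw [h] at h2
      simpa using h2.symm
    obtain ⟨a, ha⟩ : ∃ a, 1 ≤ |v a| := by
      by_contra! hcon
      have := hA v hcon b
      rw [hAv] at this
      simp at this
    have ha2 : 1 ≤ v a ^ 2 := by rw [← sq_abs]; nlinarith
    have hsplit := Finset.add_sum_erase Finset.univ (fun a => v a ^ 2) (Finset.mem_univ a)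
    have hrest : ∑ i ∈ Finset.univ.erase a, v i ^ 2 = 0 := by
      have : 0 ≤ ∑ i ∈ Finset.univ.erase a, v i ^ 2 := Finset.sum_nonneg fun _ _ => sq_nonneg _
      simp only at hsplit
      linarith
    have hzero : ∀ i, i ≠ a → v i = 0 := fun i hi => by
      have := (Finset.sum_eq_zero_iff_of_nonneg (fun _ _ => sq_nonneg _)).1 hrest i
        (Finset.mem_erase.2 ⟨hi, Finset.mem_univ _⟩)
      exact pow_eq_zero_iff (two_ne_zero) |>.1 this
    have hva : v a ^ 2 = 1 := by simp only at hsplit; linarith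
    have hAx : ∀ x, A x b = v a * x a := by
      intro x
      have h1 : A x b = inner ℝ (EuclideanSpace.single b (1 : ℝ)) (A x) := by
        simp [EuclideanSpace.inner_single_left]
      rw [h1, ← hAv, A.inner_map_map, PiLp.inner_apply, Finset.sum_eq_single a]
      · simp [mul_comm]
      · intro i _ hi; simp [hzero i hi]
      · simp
    rcases (show v a = 1 ∨ v a = -1 by simpa using hva) with h | h
    · exact ⟨a, 1, Or.inl rfl, fun x => by rw [hAx, h]; simp⟩
    · exact ⟨a, -1, Or.inr rfl, fun x => by rw [hAx, h]; simp⟩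
  choose τ s hs hτ using key
  have hinj : Function.Injective τ := by
    intro b b' hbb
    by_contra hne
    have h1 := hτ b (A.symm (EuclideanSpace.single b (1 : ℝ)))
    have h2 := hτ b' (A.symm (EuclideanSpace.single b (1 : ℝ)))
    rw [← hbb, A.apply_symm_apply] at h2
    rw [A.apply_symm_apply] at h1
    have h0 : A.symm (EuclideanSpace.single b (1 : ℝ)) (τ b) = 0 := by
      rcases hs b' with h' | h' <;> rw [h'] at h2 <;> simpa [Ne.symm hne, eq_comm] using h2
    rw [h0] at h1
    simp at h1
  exact ⟨Equiv.ofBijective τ (Finite.injective_iff_bijective.1 hinj), s, hs,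
    fun x b => hτ b x⟩

theorem eq_zero_of_unitInterval_shift {d : ℝ} (h : ∀ s, 0 < s → s < 1 → 0 < s + d ∧ s + d < 1) :
    d = 0 := by
  rcases lt_trichotomy d 0 with hd | hd | hd
  · have h1 := h (1 / 2) (by norm_num) (by norm_num)
    -- The point `s = -d` would be moved to the excluded end point 0; in the case `d > 0` below, `s
    -- = 1 - d` would be moved to 1.
    have h2 := h (-d) (by linarith) (by linarith)
    linarith
  · exact hd
  · have h1 := h (1 / 2) (by norm_num) (by norm_num)
    have h2 := h (1 - d) (by linarith) (by linarith)
    linarith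

/-- `f` maps the cubes of the lattice of edge length `δ` onto those of the lattice of edge length
`δ'`, with the indices transformed by `e`. -/
def IsCubeMap {p : ℕ} (f : EuclideanSpace ℝ (Fin p) → EuclideanSpace ℝ (Fin p)) (δ δ' : ℝ)
    (e : (Fin p → ℤ) ≃ (Fin p → ℤ)) : Prop :=
  ∀ z x, (f x ∈ openCube δ' (e z) ↔ x ∈ openCube δ z) ∧
    (f x ∈ closedCube δ' (e z) ↔ x ∈ closedCube δ z)

theorem IsCubeMap.comp {p : ℕ} {f g : EuclideanSpace ℝ (Fin p) → EuclideanSpace ℝ (Fin p)}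
    {δ δ' δ'' : ℝ} {e e' : (Fin p → ℤ) ≃ (Fin p → ℤ)} (hg : IsCubeMap g δ' δ'' e')
    (hf : IsCubeMap f δ δ' e) : IsCubeMap (g ∘ f) δ δ'' (e.trans e') := fun z x =>
  ⟨((hg (e z) (f x)).1).trans (hf z x).1, ((hg (e z) (f x)).2).trans (hf z x).2⟩

/-- The action of a signed permutation and a translation on the indices of lattice cubes. -/
def signedPermEquiv {p : ℕ} (τ : Equiv.Perm (Fin p)) (s v : Fin p → ℤ)
    (hs : ∀ b, s b = 1 ∨ s b = -1) : (Fin p → ℤ) ≃ (Fin p → ℤ) where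
  toFun z b := s b * z (τ b) + v b
  invFun z a := s (τ.symm a) * (z (τ.symm a) - v (τ.symm a))
  left_inv z := by
    funext a
    rcases hs (τ.symm a) with h | h <;> simp [h]
  right_inv z := by
    funext b
    rcases hs b with h | h <;> simp [h]

namespace SimilaritySystem

variable {p : ℕ} {ι : Type*} {S : SimilaritySystem p ι}

theorem map_apply (S : SimilaritySystem p ι) (i : ι) (x : EuclideanSpace ℝ (Fin p)) (b : Fin p) :
    S.map i x b = S.ratio * S.linear i x b + S.shift i b := by
  simp [map]

theorem exists_map_eq (hc : 0 < S.ratio) (hfit : S.FitsLattice) (i : ι) :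
    ∃ (τ : Equiv.Perm (Fin p)) (s u : Fin p → ℤ), (∀ b, s b = 1 ∨ s b = -1) ∧
      ∀ x b, S.map i x b = S.ratio * (s b * x (τ b) + u b) := by
  obtain ⟨z, hz, -⟩ := hfit.1 i
  have hmem : ∀ x ∈ openCube 1 (0 : Fin p → ℤ), S.map i x ∈ openCube S.ratio z := fun x hx => by
    rw [← hz]; exact ⟨x, hx, rfl⟩
  have hA : ∀ x, (∀ a, |x a| < 1) → ∀ a, |S.linear i x a| < 1 := by
    intro y hy b
    -- The images of the centre plus and minus `y / 2` lie in one open cube of edge `c`. Their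
    -- difference is `c • A y`, so the translation drops out.
    have ho1 := hmem (cubeCenter p + (1 / 2 : ℝ) • y) (fun a => by
      have := abs_lt.1 (hy a)
      simp [cubeCenter]; constructor <;> linarith) b
    have ho2 := hmem (cubeCenter p - (1 / 2 : ℝ) • y) (fun a => by
      have := abs_lt.1 (hy a)
      simp [cubeCenter]; constructor <;> linarith) b
    rw [map_apply] at ho1 ho2
    simp only [map_add, map_sub, map_smul, PiLp.add_apply, PiLp.sub_apply, PiLp.smul_apply,
      smul_eq_mul] at ho1 ho2
    have h1 : S.ratio * S.linear i y b < S.ratio * 1 := by linarith [ho1.2, ho2.1]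
    have h2 : S.ratio * (-1) < S.ratio * S.linear i y b := by linarith [ho1.1, ho2.2]
    exact abs_lt.2 ⟨lt_of_mul_lt_mul_left h2 hc.le, lt_of_mul_lt_mul_left h1 hc.le⟩
  obtain ⟨τ, s, hs, hτ⟩ := exists_signedPerm (S.linear i) hA
  have hpt : ∀ b (t : ℝ), 0 < t → t < 1 →
      S.ratio * z b < S.ratio * (s b * t) + S.shift i b ∧
      S.ratio * (s b * t) + S.shift i b < S.ratio * (z b + 1) := by
    intro b t h0 h1
    have := hmem (WithLp.toLp 2 fun _ => t) (fun a => by simp [h0, h1]) b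
    rw [map_apply, hτ] at this
    exact this
  have hshift : ∀ b, ∃ u : ℤ, S.shift i b = S.ratio * u := by
    intro b
    rcases hs b with h | h
    · refine ⟨z b, ?_⟩
      have : S.shift i b / S.ratio - z b = 0 := by
        refine eq_zero_of_unitInterval_shift fun t h0 h1 => ?_
        obtain ⟨h2, h3⟩ := hpt b t h0 h1
        rw [h] at h2 h3
        have e : S.shift i b = S.ratio * (S.shift i b / S.ratio) := by field_simp
        rw [e, ← mul_add] at h2 h3
        have h2 := lt_of_mul_lt_mul_left h2 hc.le
        have h3 := lt_of_mul_lt_mul_left h3 hc.le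
        push_cast at h2 h3
        constructor <;> linarith
      field_simp at this
      linarith
    · refine ⟨z b + 1, ?_⟩
      -- A reflected axis maps `(0, 1)` to the left of the shift, so the shift is the upper end of
      -- the image interval.
      have : S.shift i b / S.ratio - z b - 1 = 0 := by
        refine eq_zero_of_unitInterval_shift fun t h0 h1 => ?_
        obtain ⟨h2, h3⟩ := hpt b (1 - t) (by linarith) (by linarith)
        rw [h] at h2 h3
        have e : S.shift i b = S.ratio * (S.shift i b / S.ratio) := by field_simp
        rw [e, ← mul_add] at h2 h3
        have h2 := lt_of_mul_lt_mul_left h2 hc.le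
        have h3 := lt_of_mul_lt_mul_left h3 hc.le
        push_cast at h2 h3
        constructor <;> linarith
      field_simp at this
      push_cast
      linarith
  choose u hu using hshift
  refine ⟨τ, s, u, hs, fun x b => ?_⟩
  rw [map_apply, hτ, hu, mul_add]

theorem exists_isCubeMap_map {m : ℕ} (hm : 0 < m) (hc : S.ratio = (m : ℝ)⁻¹)
    (hfit : S.FitsLattice) (i : ι) (n : ℕ) :
    ∃ e, IsCubeMap (S.map i) (S.ratio ^ n) (S.ratio ^ (n + 1)) e := by
  have hm' : (0 : ℝ) < m := by exact_mod_cast hm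
  have hc0 : 0 < S.ratio := by rw [hc]; positivity
  obtain ⟨τ, s, u, hs, hmap⟩ := exists_map_eq hc0 hfit i
  have hone : S.ratio ^ n * (m : ℝ) ^ n = 1 := by rw [hc, ← mul_pow]; field_simp; simp
  -- The translation by `c * u` is `m ^ n * u` steps of the lattice of edge `c ^ (n + 1)`. A
  -- reflection sends `[z, z + 1]` to `[-z - 1, -z]`, whose lower end accounts for the extra `-1`.
  refine ⟨signedPermEquiv τ s (fun b => if s b = 1 then m ^ n * u b else m ^ n * u b - 1) hs,
    fun z x => ?_⟩
  have hpos : 0 < S.ratio ^ n := pow_pos hc0 n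
  have hu : ∀ b, (u b : ℝ) = S.ratio ^ n * (m ^ n * u b) := fun b => by
    rw [← mul_assoc, hone, one_mul]
  have h1 : ∀ b, (S.ratio ^ (n + 1) * ((signedPermEquiv τ s
      (fun b => if s b = 1 then m ^ n * u b else m ^ n * u b - 1) hs z b : ℤ) : ℝ) < S.map i x b ∧
      S.map i x b < S.ratio ^ (n + 1) * ((signedPermEquiv τ s
      (fun b => if s b = 1 then m ^ n * u b else m ^ n * u b - 1) hs z b : ℤ) + 1)) ↔
      (S.ratio ^ n * z (τ b) < x (τ b) ∧ x (τ b) < S.ratio ^ n * (z (τ b) + 1)) := by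
    intro b
    rw [hmap, pow_succ', mul_assoc, mul_assoc, mul_lt_mul_iff_right₀ hc0,
      mul_lt_mul_iff_right₀ hc0]
    have hub := hu b
    rcases hs b with h | h
    · simp [signedPermEquiv, h]
      constructor <;> rintro ⟨h2, h3⟩ <;> constructor <;> linarith
    · simp [signedPermEquiv, h]
      constructor <;> rintro ⟨h2, h3⟩ <;> constructor <;> linarith
  have h2 : ∀ b, (S.ratio ^ (n + 1) * ((signedPermEquiv τ s
      (fun b => if s b = 1 then m ^ n * u b else m ^ n * u b - 1) hs z b : ℤ) : ℝ) ≤ S.map i x b ∧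
      S.map i x b ≤ S.ratio ^ (n + 1) * ((signedPermEquiv τ s
      (fun b => if s b = 1 then m ^ n * u b else m ^ n * u b - 1) hs z b : ℤ) + 1)) ↔
      (S.ratio ^ n * z (τ b) ≤ x (τ b) ∧ x (τ b) ≤ S.ratio ^ n * (z (τ b) + 1)) := by
    intro b
    rw [hmap, pow_succ', mul_assoc, mul_assoc, mul_le_mul_iff_right₀ hc0,
      mul_le_mul_iff_right₀ hc0]
    have hub := hu b
    rcases hs b with h | h
    · simp [signedPermEquiv, h]
      constructor <;> rintro ⟨h2, h3⟩ <;> constructor <;> linarith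
    · simp [signedPermEquiv, h]
      constructor <;> rintro ⟨h2, h3⟩ <;> constructor <;> linarith
  constructor
  · exact (forall_congr' h1).trans (τ.forall_congr_right
      (q := fun b => S.ratio ^ n * z b < x b ∧ x b < S.ratio ^ n * (z b + 1)))
  · exact (forall_congr' h2).trans (τ.forall_congr_right
      (q := fun b => S.ratio ^ n * z b ≤ x b ∧ x b ≤ S.ratio ^ n * (z b + 1)))

end SimilaritySystem

namespace SimilaritySystem

variable {p : ℕ} {ι : Type*} {S : SimilaritySystem p ι} {M : Set (EuclideanSpace ℝ (Fin p))}

/-! ### Words and cells -/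

theorem wordMap_append (S : SimilaritySystem p ι) (u v : List ι) (x : EuclideanSpace ℝ (Fin p)) :
    S.wordMap (u ++ v) x = S.wordMap u (S.wordMap v x) := by
  induction u with
  | nil => rfl
  | cons i u ih => simp [wordMap, ih]

theorem wordMap_singleton (S : SimilaritySystem p ι) (i : ι) (x : EuclideanSpace ℝ (Fin p)) :
    S.wordMap [i] x = S.map i x := rfl

theorem wordMap_replicate (S : SimilaritySystem p ι) (i : ι) (n : ℕ) :
    S.wordMap (List.replicate n i) = (S.map i)^[n] := by
  induction n with
  | zero => rfl
  | succ n ih => rw [List.replicate_succ, wordMap, ih, Function.iterate_succ']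

theorem map_bijective (hc : 0 < S.ratio) (i : ι) : Function.Bijective (S.map i) := by
  constructor
  · intro x y h
    have h : S.ratio • S.linear i x + S.shift i = S.ratio • S.linear i y + S.shift i := h
    exact (S.linear i).injective (smul_right_injective _ hc.ne' (add_right_cancel h))
  · intro y
    refine ⟨(S.linear i).symm (S.ratio⁻¹ • (y - S.shift i)), ?_⟩
    simp [map, smul_smul, hc.ne']

theorem wordMap_bijective (hc : 0 < S.ratio) (w : List ι) : Function.Bijective (S.wordMap w) := by
  induction w with
  | nil => exact Function.bijective_id
  | cons i w ih => exact (map_bijective hc i).comp ih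

theorem norm_map_sub_map (hc : 0 < S.ratio) (i : ι) (x y : EuclideanSpace ℝ (Fin p)) :
    ‖S.map i x - S.map i y‖ = S.ratio * ‖x - y‖ := by
  rw [map, map, add_sub_add_right_eq_sub, ← smul_sub, ← map_sub, norm_smul,
    LinearIsometryEquiv.norm_map, Real.norm_of_nonneg hc.le]

theorem IsSelfSimilarSet.map_mem (hM : S.IsSelfSimilarSet M) (i : ι)
    {x : EuclideanSpace ℝ (Fin p)} (hx : x ∈ M) : S.map i x ∈ M := by
  rw [hM.2.2]; exact Set.mem_iUnion.2 ⟨i, x, hx, rfl⟩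

theorem IsSelfSimilarSet.exists_map_eq (hM : S.IsSelfSimilarSet M)
    {x : EuclideanSpace ℝ (Fin p)} (hx : x ∈ M) : ∃ i, ∃ y ∈ M, S.map i y = x := by
  rw [hM.2.2] at hx; exact Set.mem_iUnion.1 hx

theorem IsSelfSimilarSet.wordMap_mem (hM : S.IsSelfSimilarSet M) (w : List ι)
    {x : EuclideanSpace ℝ (Fin p)} (hx : x ∈ M) : S.wordMap w x ∈ M := by
  induction w with
  | nil => exact hx
  | cons i w ih => exact hM.map_mem i ih

theorem IsSelfSimilarSet.exists_wordMap_eq (hM : S.IsSelfSimilarSet M) (n : ℕ)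
    {x : EuclideanSpace ℝ (Fin p)} (hx : x ∈ M) :
    ∃ w : List ι, w.length = n ∧ ∃ y ∈ M, S.wordMap w y = x := by
  induction n generalizing x with
  | zero => exact ⟨[], rfl, x, hx, rfl⟩
  | succ n ih =>
    obtain ⟨i, y, hy, rfl⟩ := hM.exists_map_eq hx
    obtain ⟨w, hw, y', hy', rfl⟩ := ih hy
    exact ⟨i :: w, by simp [hw], y', hy', rfl⟩

theorem exists_isCubeMap_wordMap {m : ℕ} (hm : 0 < m) (hc : S.ratio = (m : ℝ)⁻¹)
    (hfit : S.FitsLattice) (w : List ι) :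
    ∃ e, IsCubeMap (S.wordMap w) 1 (S.ratio ^ w.length) e := by
  induction w with
  | nil => exact ⟨Equiv.refl _, fun z x => by simp [wordMap]⟩
  | cons i w ih =>
    obtain ⟨e, he⟩ := ih
    obtain ⟨e', he'⟩ := exists_isCubeMap_map hm hc hfit i w.length
    exact ⟨_, he'.comp he⟩

theorem FitsLattice.map_mem_openCube (hfit : S.FitsLattice) (i : ι)
    {x : EuclideanSpace ℝ (Fin p)} (hx : x ∈ openCube 1 (0 : Fin p → ℤ)) :
    S.map i x ∈ openCube 1 (0 : Fin p → ℤ) := by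
  obtain ⟨z, hz, hz'⟩ := hfit.1 i
  exact hz' (hz ▸ ⟨x, hx, rfl⟩)

theorem FitsLattice.wordMap_mem_openCube (hfit : S.FitsLattice) (w : List ι)
    {x : EuclideanSpace ℝ (Fin p)} (hx : x ∈ openCube 1 (0 : Fin p → ℤ)) :
    S.wordMap w x ∈ openCube 1 (0 : Fin p → ℤ) := by
  induction w with
  | nil => exact hx
  | cons i w ih => exact hfit.map_mem_openCube i ih

/-- The first letters agree because the first-level cells are disjoint; cancelling the injective
first map leaves shorter words. -/
theorem FitsLattice.eq_of_wordMap_eq (hfit : S.FitsLattice) (hc : 0 < S.ratio) {w w' : List ι}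
    (hlen : w.length = w'.length) {x y : EuclideanSpace ℝ (Fin p)}
    (hx : x ∈ openCube 1 (0 : Fin p → ℤ)) (hy : y ∈ openCube 1 (0 : Fin p → ℤ))
    (h : S.wordMap w x = S.wordMap w' y) : w = w' := by
  induction w generalizing w' with
  | nil => exact (List.length_eq_zero_iff.1 hlen.symm).symm
  | cons i w ih =>
    cases w' with
    | nil => simp at hlen
    | cons j w' =>
      have hij : i = j := by
        by_contra hne
        exact Set.disjoint_left.1 (hfit.2 hne) ⟨_, hfit.wordMap_mem_openCube w hx, h⟩
          ⟨_, hfit.wordMap_mem_openCube w' hy, rfl⟩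
      subst hij
      rw [ih (by simpa using hlen) ((map_bijective hc i).1 h)]

theorem mem_closedCube_of_tendsto {x : EuclideanSpace ℝ (Fin p)} {c B : ℝ} (hc0 : 0 ≤ c)
    (hc1 : c < 1)
    (h : ∀ n : ℕ, ∃ q ∈ closedCube 1 (0 : Fin p → ℤ), ‖x - q‖ ≤ c ^ n * B) :
    x ∈ closedCube 1 (0 : Fin p → ℤ) := by
  have hlim : Tendsto (fun n : ℕ => c ^ n * B) atTop (𝓝 0) := by
    simpa using (tendsto_pow_atTop_nhds_zero_of_lt_one hc0 hc1).mul_const B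
  have hab : ∀ a n, -(c ^ n * B) ≤ x a ∧ x a ≤ 1 + c ^ n * B := by
    intro a n
    obtain ⟨q, hq, hn⟩ := h n
    have h1 := abs_le.1 ((PiLp.norm_apply_le (x - q) a).trans hn)
    have h2 := hq a
    simp at h1 h2
    constructor <;> linarith
  intro a
  have h1 := ge_of_tendsto' hlim (b := -x a) fun n => by linarith [(hab a n).1]
  have h2 := ge_of_tendsto' hlim (b := x a - 1) fun n => by linarith [(hab a n).2]
  simp
  constructor <;> linarith

/-- Any `x ∈ M` is `S_w y` with `y ∈ M` and `w` of length `n`. It is within `c ^ n * ‖y‖` of the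
point `S_w 0` of the closed cube, and `‖y‖` is bounded on `M`. -/
theorem IsSelfSimilarSet.subset_closedCube (hM : S.IsSelfSimilarSet M)
    (hc0 : 0 < S.ratio) (hc1 : S.ratio < 1)
    (hcl : ∀ i, ∀ x ∈ closedCube 1 (0 : Fin p → ℤ), S.map i x ∈ closedCube 1 (0 : Fin p → ℤ)) :
    M ⊆ closedCube 1 (0 : Fin p → ℤ) := by
  obtain ⟨B, hB⟩ := hM.2.1.exists_norm_le
  intro x hx
  refine mem_closedCube_of_tendsto (B := B) hc0.le hc1 fun n => ?_
  induction n generalizing x with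
  | zero => exact ⟨0, fun a => by simp, by simpa using hB x hx⟩
  | succ n ih =>
    obtain ⟨i, y, hy, rfl⟩ := hM.exists_map_eq hx
    obtain ⟨q, hq, hqn⟩ := ih hy
    refine ⟨S.map i q, hcl i q hq, ?_⟩
    rw [norm_map_sub_map hc0, pow_succ', mul_assoc]
    exact mul_le_mul_of_nonneg_left hqn hc0.le

/-- `E` codes the action of the word maps on the lattices; the cubes of the lattice of edge length
`c ^ n` whose interiors meet `M` are exactly those with the indices `E w 0`, `w` of length `n`. -/
structure IsCoding (S : SimilaritySystem p ι) (M : Set (EuclideanSpace ℝ (Fin p))) (m : ℕ)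
    (E : List ι → (Fin p → ℤ) ≃ (Fin p → ℤ)) : Prop where
  two_le : 2 ≤ m
  ratio_eq : S.ratio = (m : ℝ)⁻¹
  isCubeMap : ∀ w, IsCubeMap (S.wordMap w) 1 (S.ratio ^ w.length) (E w)
  inj : ∀ w w', w.length = w'.length → E w 0 = E w' 0 → w = w'
  mem_iff : ∀ n z, (openCube (S.ratio ^ n) z ∩ M).Nonempty ↔ ∃ w, w.length = n ∧ E w 0 = z
  exists_mem : ∀ n, ∀ x ∈ M, ∃ w, w.length = n ∧ x ∈ closedCube (S.ratio ^ n) (E w 0)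
  wordMap_mem : ∀ w, ∀ x ∈ openCube 1 (0 : Fin p → ℤ), S.wordMap w x ∈ openCube 1 (0 : Fin p → ℤ)
  isSelfSimilarSet : S.IsSelfSimilarSet M

theorem exists_isCoding {m : ℕ} (hm : 2 ≤ m) (hc : S.ratio = (m : ℝ)⁻¹)
    (hM : S.IsSelfSimilarSet M) (hfit : S.FitsLattice)
    (hmeet : ∃ i, ∃ x ∈ M, x ∈ S.map i '' openCube 1 0) :
    ∃ E, S.IsCoding M m E := by
  have hm' : (2 : ℝ) ≤ m := by exact_mod_cast hm
  have hc0 : 0 < S.ratio := by rw [hc]; positivity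
  have hc1 : S.ratio < 1 := by rw [hc]; exact inv_lt_one_of_one_lt₀ (by linarith)
  choose E hE using exists_isCubeMap_wordMap (S := S) (by omega) hc hfit
  have hcl : ∀ i, ∀ x ∈ closedCube 1 (0 : Fin p → ℤ),
      S.map i x ∈ closedCube 1 (0 : Fin p → ℤ) := by
    intro i x hx a
    have h1 := ((hE [i] 0 x).2.2 hx) a
    have hcen := ((hE [i] 0 (cubeCenter p)).1.2 (cubeCenter_mem p)) a
    have hcen' := hfit.map_mem_openCube i (cubeCenter_mem p) a
    rw [wordMap_singleton] at h1 hcen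
    simp only [List.length_singleton, pow_one, Pi.zero_apply, Int.cast_zero, mul_zero, zero_add,
      mul_one] at h1 hcen hcen' ⊢
    -- The centre of the cell lies strictly inside the unit cube, which confines the integer index
    -- to `0 ≤ E [i] 0 a < m`. The closed cell is then inside the closed unit cube.
    have hmc : S.ratio * m = 1 := by rw [hc]; field_simp
    have h2 : (0 : ℝ) < E [i] 0 a + 1 := by
      have : S.ratio * 0 < S.ratio * (E [i] 0 a + 1) := by linarith [hcen.2, hcen'.1]
      exact lt_of_mul_lt_mul_left this hc0.le
    have h3 : (E [i] 0 a : ℝ) < m := by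
      have : S.ratio * E [i] 0 a < S.ratio * m := by linarith [hcen.1, hcen'.2]
      exact lt_of_mul_lt_mul_left this hc0.le
    have h2 : (0 : ℤ) < E [i] 0 a + 1 := by exact_mod_cast h2
    have h3 : E [i] 0 a < (m : ℤ) := by exact_mod_cast h3
    have h2 : (0 : ℝ) ≤ E [i] 0 a := by exact_mod_cast Int.lt_add_one_iff.1 h2
    have h3 : (E [i] 0 a : ℝ) + 1 ≤ m := by exact_mod_cast Int.add_one_le_iff.2 h3
    constructor
    · exact (mul_nonneg hc0.le h2).trans h1.1
    · have := mul_le_mul_of_nonneg_left h3 hc0.le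
      linarith [h1.2]
  have hsub := hM.subset_closedCube hc0 hc1 hcl
  have hex : ∀ n, ∀ x ∈ M, ∃ w : List ι, w.length = n ∧
      x ∈ closedCube (S.ratio ^ n) (E w 0) := by
    intro n x hx
    obtain ⟨w, rfl, y, hy, rfl⟩ := hM.exists_wordMap_eq n hx
    exact ⟨w, rfl, (hE w 0 y).2.2 (hsub hy)⟩
  have hmeet' : ∃ y ∈ M, y ∈ openCube 1 (0 : Fin p → ℤ) := by
    obtain ⟨i, _, hx, y, hy, rfl⟩ := hmeet
    exact ⟨_, hx, hfit.map_mem_openCube i hy⟩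
  refine ⟨E, hm, hc, hE, ?_, ?_, hex, fun w _ => hfit.wordMap_mem_openCube w, hM⟩
  · intro w w' hlen h
    obtain ⟨y, hy⟩ := (wordMap_bijective hc0 w').2 (S.wordMap w (cubeCenter p))
    refine hfit.eq_of_wordMap_eq hc0 hlen (cubeCenter_mem p) (y := y) ?_ hy.symm
    rw [← (hE w' 0 y).1, hy, ← h, ← hlen]
    exact (hE w 0 _).1.2 (cubeCenter_mem p)
  · intro n z
    constructor
    · rintro ⟨x, hxz, hxM⟩
      obtain ⟨w, hw, hx⟩ := hex n x hxM
      exact ⟨w, hw, (eq_of_openCube_inter_closedCube (pow_pos hc0 n) hxz hx).symm⟩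
    -- A single point of `M` in the open unit cube is carried by `S_w` into the interior of the cell
    -- of `w`, so no cell is missed.
    · rintro ⟨w, rfl, rfl⟩
      obtain ⟨y, hyM, hy⟩ := hmeet'
      exact ⟨S.wordMap w y, (hE w 0 y).1.2 hy, hM.wordMap_mem w hyM⟩

namespace IsCoding

variable {m : ℕ} {E : List ι → (Fin p → ℤ) ≃ (Fin p → ℤ)}

theorem ratio_pos (h : S.IsCoding M m E) : 0 < S.ratio := by
  have := h.two_le
  rw [h.ratio_eq]; positivity

theorem ratio_mul (h : S.IsCoding M m E) : S.ratio * m = 1 := by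
  have := h.two_le
  have : (m : ℝ) ≠ 0 := by positivity
  rw [h.ratio_eq]; field_simp

theorem touch_iff (h : S.IsCoding M m E) (w : List ι) (z z' : Fin p → ℤ) :
    (∀ a, |E w z a - E w z' a| ≤ 1) ↔ ∀ a, |z a - z' a| ≤ 1 := by
  rw [← closedCube_inter_nonempty_iff (pow_pos h.ratio_pos w.length),
    ← closedCube_inter_nonempty_iff one_pos]
  constructor
  · rintro ⟨y, h1, h2⟩
    obtain ⟨x, rfl⟩ := (wordMap_bijective h.ratio_pos w).2 y
    exact ⟨x, (h.isCubeMap w z x).2.1 h1, (h.isCubeMap w z' x).2.1 h2⟩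
  · rintro ⟨x, h1, h2⟩
    exact ⟨S.wordMap w x, (h.isCubeMap w z x).2.2 h1, (h.isCubeMap w z' x).2.2 h2⟩

theorem mem_closedCube_append_iff (h : S.IsCoding M m E) (u v : List ι)
    (x : EuclideanSpace ℝ (Fin p)) :
    S.wordMap u x ∈ closedCube (S.ratio ^ (u ++ v).length) (E (u ++ v) 0) ↔
      x ∈ closedCube (S.ratio ^ v.length) (E v 0) := by
  obtain ⟨y, rfl⟩ := (wordMap_bijective h.ratio_pos v).2 x
  rw [(h.isCubeMap v 0 y).2, ← wordMap_append, (h.isCubeMap (u ++ v) 0 y).2]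

theorem touch_append_iff (h : S.IsCoding M m E) (u : List ι) {v v' : List ι}
    (hlen : v.length = v'.length) :
    (∀ a, |E (u ++ v) 0 a - E (u ++ v') 0 a| ≤ 1) ↔ ∀ a, |E v 0 a - E v' 0 a| ≤ 1 := by
  have hlen' : (u ++ v).length = (u ++ v').length := by simp [hlen]
  rw [← closedCube_inter_nonempty_iff (pow_pos h.ratio_pos (u ++ v).length),
    ← closedCube_inter_nonempty_iff (pow_pos h.ratio_pos v.length)]
  constructor
  · rintro ⟨y, h1, h2⟩
    obtain ⟨x, rfl⟩ := (wordMap_bijective h.ratio_pos u).2 y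
    rw [hlen'] at h2
    have h2 := (h.mem_closedCube_append_iff u v' x).1 h2
    rw [← hlen] at h2
    exact ⟨x, (h.mem_closedCube_append_iff u v x).1 h1, h2⟩
  · rintro ⟨x, h1, h2⟩
    rw [hlen] at h2
    have h2 := (h.mem_closedCube_append_iff u v' x).2 h2
    rw [← hlen'] at h2
    exact ⟨S.wordMap u x, (h.mem_closedCube_append_iff u v x).2 h1, h2⟩

theorem wordMap_center_mem (h : S.IsCoding M m E) (w : List ι) :
    S.wordMap w (cubeCenter p) ∈ openCube (S.ratio ^ w.length) (E w 0) :=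
  (h.isCubeMap w 0 _).1.2 (cubeCenter_mem p)

/-- The cell of `u ++ v` lies in the cell of `u`, whose edge is `m ^ |v|` times as long; passing to
a prefix is therefore integer division of the index. -/
theorem cell_ediv (h : S.IsCoding M m E) (u v : List ι) (a : Fin p) :
    E u 0 a = E (u ++ v) 0 a / (m ^ v.length : ℕ) := by
  have h2 := h.two_le
  refine eq_ediv_of_openCube_inter (pow_pos h.ratio_pos (u ++ v).length) (by positivity)
    (h.wordMap_center_mem (u ++ v)) ?_ a
  have : S.ratio ^ (u ++ v).length * ((m ^ v.length : ℕ) : ℝ) = S.ratio ^ u.length := by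
    rw [List.length_append, pow_add, Nat.cast_pow, mul_assoc, ← mul_pow, h.ratio_mul, one_pow,
      mul_one]
  rw [this, wordMap_append]
  exact (h.isCubeMap u 0 _).1.2 (h.wordMap_mem v _ (cubeCenter_mem p))

end IsCoding

end SimilaritySystem

/-! ### Balls in graphs -/

theorem mem_neighborhood_iff {V : Type*} {G : SimpleGraph V} {n : ℕ} {x y : V} :
    y ∈ neighborhood G n x ↔ ∃ q : G.Walk x y, q.length ≤ n := by
  constructor
  · intro h
    have h : G.edist x y ≤ n := h
    have hne : G.edist x y ≠ ⊤ := ne_top_of_le_ne_top (ENat.natCast_ne_top n) h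
    obtain ⟨q, hq⟩ := SimpleGraph.exists_walk_of_edist_ne_top hne
    exact ⟨q, by rw [← hq] at h; exact_mod_cast h⟩
  · rintro ⟨q, hq⟩
    exact (q.edist_le).trans (by exact_mod_cast hq)

theorem neighborhood_mono {V : Type*} {G : SimpleGraph V} {n n' : ℕ} (h : n ≤ n') (x : V) :
    neighborhood G n x ⊆ neighborhood G n' x := fun _ hy =>
  le_trans (show G.edist _ _ ≤ _ from hy) (by exact_mod_cast h)

theorem mem_neighborhood_trans {V : Type*} {G : SimpleGraph V} {n n' : ℕ} {x y z : V}
    (h : y ∈ neighborhood G n x) (h' : z ∈ neighborhood G n' y) :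
    z ∈ neighborhood G (n + n') x := by
  obtain ⟨q, hq⟩ := mem_neighborhood_iff.1 h
  obtain ⟨q', hq'⟩ := mem_neighborhood_iff.1 h'
  exact mem_neighborhood_iff.2 ⟨q.append q', by rw [SimpleGraph.Walk.length_append]; omega⟩

theorem mem_neighborhood_comm {V : Type*} {G : SimpleGraph V} {n : ℕ} {x y : V} :
    y ∈ neighborhood G n x ↔ x ∈ neighborhood G n y := by
  simp only [neighborhood, Set.mem_ofPred_eq, SimpleGraph.edist_comm]

theorem mem_neighborhood_one {V : Type*} {G : SimpleGraph V} {x y : V} (h : G.Adj x y) :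
    y ∈ neighborhood G 1 x := mem_neighborhood_iff.2 ⟨h.toWalk, by simp⟩

theorem mem_neighborhood_self {V : Type*} {G : SimpleGraph V} (n : ℕ) (x : V) :
    x ∈ neighborhood G n x := mem_neighborhood_iff.2 ⟨.nil, by simp⟩

theorem mem_neighborhood_map {V W : Type*} {G : SimpleGraph V} {H : SimpleGraph W} (f : G →g H)
    {n : ℕ} {x y : V} (h : y ∈ neighborhood G n x) : f y ∈ neighborhood H n (f x) := by
  obtain ⟨q, hq⟩ := mem_neighborhood_iff.1 h
  exact mem_neighborhood_iff.2 ⟨q.map f, by simpa using hq⟩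

theorem exists_mem_neighborhood {V : Type*} {G : SimpleGraph V} {x y : V} (h : G.Reachable x y) :
    ∃ n, y ∈ neighborhood G n x := by
  obtain ⟨q⟩ := h
  exact ⟨q.length, mem_neighborhood_iff.2 ⟨q, le_rfl⟩⟩

/-- If `f` displaces the end points of bonds by at most `k`-balls, it does so with all balls. -/
theorem mem_neighborhood_of_adj {V W : Type*} {G : SimpleGraph V} {H : SimpleGraph W} {f : V → W}
    {k : ℕ} (hf : ∀ x y, G.Adj x y → f y ∈ neighborhood H k (f x)) {n : ℕ} {x y : V}
    (h : y ∈ neighborhood G n x) : f y ∈ neighborhood H (k * n) (f x) := by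
  obtain ⟨q, hq⟩ := mem_neighborhood_iff.1 h
  refine neighborhood_mono (Nat.mul_le_mul_left k hq) _ ?_
  clear hq h
  induction q with
  | nil => exact mem_neighborhood_self _ _
  | cons hadj q ih =>
    rw [SimpleGraph.Walk.length_cons, mul_add, mul_one, add_comm]
    exact mem_neighborhood_trans (hf _ _ hadj) ih

theorem coverGraph_adj_iff {p : ℕ} {δ : ℝ} (hδ : 0 < δ) {M : Set (EuclideanSpace ℝ (Fin p))}
    (u v : CoverNode δ M) :
    (coverGraph δ M).Adj u v ↔ u ≠ v ∧ ∀ a, |u.1 a - v.1 a| ≤ 1 :=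
  and_congr_right fun _ => closedCube_inter_nonempty_iff hδ _ _

/-- One bond changes each coordinate by at most one. The map `e` allows the indices to be compared
after a transfer to another scale. -/
theorem abs_sub_le_of_mem_neighborhood {p : ℕ} {δ : ℝ} (hδ : 0 < δ)
    {M : Set (EuclideanSpace ℝ (Fin p))} {e : (Fin p → ℤ) → Fin p → ℤ}
    (he : ∀ z z', (∀ a, |z a - z' a| ≤ 1) → ∀ a, |e z a - e z' a| ≤ 1) {n : ℕ}
    {x y : CoverNode δ M} (h : y ∈ neighborhood (coverGraph δ M) n x) (a : Fin p) :
    |e y.1 a - e x.1 a| ≤ n := by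
  obtain ⟨q, hq⟩ := mem_neighborhood_iff.1 h
  suffices |e y.1 a - e x.1 a| ≤ q.length from this.trans (by exact_mod_cast hq)
  clear hq h
  induction q with
  | nil => simp
  | cons hadj q ih =>
    have h1 := he _ _ ((coverGraph_adj_iff hδ _ _).1 hadj).2 a
    rw [SimpleGraph.Walk.length_cons]
    push_cast
    rw [abs_le] at *
    constructor <;> linarith [h1.1, h1.2, ih.1, ih.2]

theorem neighborhood_coverGraph_finite {p : ℕ} {δ : ℝ} (hδ : 0 < δ)
    {M : Set (EuclideanSpace ℝ (Fin p))} (n : ℕ) (x : CoverNode δ M) :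
    (neighborhood (coverGraph δ M) n x).Finite := by
  refine Set.Finite.of_finite_image (f := Subtype.val) ?_ Subtype.val_injective.injOn
  refine (Set.finite_Icc (x.1 - fun _ => (n : ℤ)) (x.1 + fun _ => (n : ℤ))).subset ?_
  rintro _ ⟨y, hy, rfl⟩
  have := fun a => abs_le.1 (abs_sub_le_of_mem_neighborhood hδ (e := id) (fun _ _ h => h) hy a)
  refine ⟨fun a => ?_, fun a => ?_⟩
  · have := (this a).1
    simp at this ⊢
    linarith
  · have := (this a).2
    simp at this ⊢
    linarith

theorem card_Icc_sub_add_one {p : ℕ} (b : Fin p → ℤ) :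
    (Finset.Icc (b - 1) (b + 1)).card = 3 ^ p := by
  have : ∀ a, (Finset.Icc ((b - 1) a) ((b + 1) a)).card = 3 := fun a => by
    simp only [Int.card_Icc, Pi.sub_apply, Pi.add_apply, Pi.one_apply]; omega
  rw [Pi.card_Icc, Finset.prod_congr rfl fun a _ => this a]
  simp

theorem natCard_vector (ι : Type*) [Finite ι] (n : ℕ) :
    Nat.card (List.Vector ι n) = Nat.card ι ^ n := by
  have : Fintype ι := Fintype.ofFinite ι
  simp only [Nat.card_eq_fintype_card, card_vector]

/-! ### Words as nodes of the construction steps and of the infinite adjoint graph -/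

namespace SimilaritySystem

variable {p : ℕ} {ι : Type*} {S : SimilaritySystem p ι} {M : Set (EuclideanSpace ℝ (Fin p))}

/-- The construction steps in terms of words: two different words of equal length are joined iff
their cells have a common point. -/
def wordGraph (E : List ι → (Fin p → ℤ) ≃ (Fin p → ℤ)) : SimpleGraph (List ι) where
  Adj u v := u ≠ v ∧ u.length = v.length ∧ ∀ a, |E u 0 a - E v 0 a| ≤ 1
  symm := ⟨fun _ _ h => ⟨h.1.symm, h.2.1.symm, fun a => by rw [abs_sub_comm]; exact h.2.2 a⟩⟩
  loopless := ⟨fun _ h => h.1 rfl⟩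

/-- The letter `i` carries outer bonds. -/
def IsMarginalLetter (E : List ι → (Fin p → ℤ) ≃ (Fin p → ℤ)) (i : ι) : Prop :=
  ∃ w w' : List ι, w.length = w'.length ∧ w ≠ w' ∧ ∃ j,
    ∀ a, |E (w ++ [i]) 0 a - E (w' ++ [j]) 0 a| ≤ 1

namespace IsCoding

variable {m : ℕ} {E : List ι → (Fin p → ℤ) ≃ (Fin p → ℤ)}

/-- The copy of a construction step with the prefix `u` in a later step. -/
def prefixHom (h : S.IsCoding M m E) (u : List ι) : wordGraph E →g wordGraph E where
  toFun w := u ++ w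
  map_rel' := fun {v v'} hadj => ⟨fun hh => hadj.1 (List.append_cancel_left hh),
    by simp [hadj.2.1], (h.touch_append_iff u hadj.2.1).2 hadj.2.2⟩

/-- The index of the cube of the infinite adjoint graph that corresponds to the word `w`. -/
def nodeIndex (E : List ι → (Fin p → ℤ) ≃ (Fin p → ℤ)) (i₀ : ι) (w : List ι) : Fin p → ℤ :=
  (E (List.replicate w.length i₀)).symm (E w 0)

theorem apply_nodeIndex (i₀ : ι) (w : List ι) :
    E (List.replicate w.length i₀) (nodeIndex E i₀ w) = E w 0 := Equiv.apply_symm_apply _ _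

theorem mem_openCube_nodeIndex_iff (h : S.IsCoding M m E) (i₀ : ι) (w : List ι)
    (x : EuclideanSpace ℝ (Fin p)) :
    x ∈ openCube 1 (nodeIndex E i₀ w) ↔
      (S.map i₀)^[w.length] x ∈ openCube (S.ratio ^ w.length) (E w 0) := by
  rw [← (h.isCubeMap (List.replicate w.length i₀) _ x).1, apply_nodeIndex, wordMap_replicate,
    List.length_replicate]

/-- The prefix `i₀ ^ n` is cancelled by the `n` additional inverse maps in the blow-up. This makes
the embeddings of the steps compatible with each other. -/
theorem nodeIndex_append (h : S.IsCoding M m E) (i₀ : ι) (n : ℕ) (w : List ι) :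
    nodeIndex E i₀ (List.replicate n i₀ ++ w) = nodeIndex E i₀ w := by
  obtain ⟨x, hx⟩ := openCube_nonempty one_pos (nodeIndex E i₀ w)
  refine (eq_of_openCube_inter_closedCube one_pos hx (openCube_subset_closedCube _ _ ?_)).symm
  rw [h.mem_openCube_nodeIndex_iff] at hx ⊢
  obtain ⟨y, hy⟩ := (wordMap_bijective h.ratio_pos w).2 ((S.map i₀)^[w.length] x)
  rw [← hy, (h.isCubeMap w 0 y).1] at hx
  rw [List.length_append, List.length_replicate, Function.iterate_add_apply, ← hy,
    ← wordMap_replicate, ← wordMap_append]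
  have := (h.isCubeMap (List.replicate n i₀ ++ w) 0 y).1.2 hx
  rwa [List.length_append, List.length_replicate] at this

theorem exists_nodeIndex_iff (h : S.IsCoding M m E) (i₀ : ι) (z : Fin p → ℤ) :
    (openCube 1 z ∩ S.blowUp i₀ M).Nonempty ↔ ∃ w, nodeIndex E i₀ w = z := by
  constructor
  · rintro ⟨x, hx, hxM⟩
    obtain ⟨n, hn⟩ := Set.mem_iUnion.1 hxM
    have hn : (S.map i₀)^[n] x ∈ M := hn
    have h1 := (h.isCubeMap (List.replicate n i₀) z x).1.2 hx
    rw [wordMap_replicate, List.length_replicate] at h1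
    obtain ⟨w, rfl, hw⟩ := (h.mem_iff n _).1 ⟨_, h1, hn⟩
    exact ⟨w, by rw [nodeIndex, hw, Equiv.symm_apply_apply]⟩
  · rintro ⟨w, rfl⟩
    obtain ⟨y, hy, hyM⟩ := (h.mem_iff w.length (E w 0)).2 ⟨w, rfl, rfl⟩
    obtain ⟨x, rfl⟩ := (wordMap_bijective h.ratio_pos (List.replicate w.length i₀)).2 y
    rw [wordMap_replicate] at hy hyM
    exact ⟨x, (h.mem_openCube_nodeIndex_iff i₀ w x).2 hy, Set.mem_iUnion.2 ⟨w.length, hyM⟩⟩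

theorem nodeIndex_touch_iff (h : S.IsCoding M m E) (i₀ : ι) {w w' : List ι}
    (hlen : w.length = w'.length) :
    (∀ a, |nodeIndex E i₀ w a - nodeIndex E i₀ w' a| ≤ 1) ↔ ∀ a, |E w 0 a - E w' 0 a| ≤ 1 := by
  rw [← h.touch_iff (List.replicate w.length i₀), apply_nodeIndex, hlen, apply_nodeIndex]

theorem nodeIndex_inj (h : S.IsCoding M m E) (i₀ : ι) {w w' : List ι}
    (hlen : w.length = w'.length) (heq : nodeIndex E i₀ w = nodeIndex E i₀ w') : w = w' := by
  refine h.inj _ _ hlen ?_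
  rw [← apply_nodeIndex i₀ w, heq, hlen, apply_nodeIndex]

/-- The node of the infinite adjoint graph that corresponds to the word `w`. -/
def node (h : S.IsCoding M m E) (i₀ : ι) (w : List ι) : CoverNode 1 (S.blowUp i₀ M) :=
  ⟨nodeIndex E i₀ w, (h.exists_nodeIndex_iff i₀ _).2 ⟨w, rfl⟩⟩

theorem node_append (h : S.IsCoding M m E) (i₀ : ι) (n : ℕ) (w : List ι) :
    h.node i₀ (List.replicate n i₀ ++ w) = h.node i₀ w := Subtype.ext (h.nodeIndex_append i₀ n w)

theorem node_inj (h : S.IsCoding M m E) (i₀ : ι) {w w' : List ι}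
    (hlen : w.length = w'.length) (heq : h.node i₀ w = h.node i₀ w') : w = w' :=
  h.nodeIndex_inj i₀ hlen (congrArg Subtype.val heq)

theorem node_replicate (h : S.IsCoding M m E) (i₀ : ι) (n : ℕ) :
    h.node i₀ (List.replicate n i₀) = h.node i₀ [] := by
  simpa using h.node_append i₀ n []

theorem adj_node_iff (h : S.IsCoding M m E) (i₀ : ι) {w w' : List ι}
    (hlen : w.length = w'.length) :
    (S.adjointGraph i₀ M).Adj (h.node i₀ w) (h.node i₀ w') ↔ (wordGraph E).Adj w w' := by
  rw [coverGraph_adj_iff one_pos]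
  constructor
  · rintro ⟨hne, ht⟩
    exact ⟨fun hh => hne (by rw [hh]), hlen, (h.nodeIndex_touch_iff i₀ hlen).1 ht⟩
  · rintro ⟨hne, -, ht⟩
    exact ⟨fun hh => hne (h.node_inj i₀ hlen hh), (h.nodeIndex_touch_iff i₀ hlen).2 ht⟩

/-- The embedding of the construction steps into the infinite adjoint graph. -/
def nodeHom (h : S.IsCoding M m E) (i₀ : ι) : wordGraph E →g S.adjointGraph i₀ M where
  toFun := h.node i₀
  map_rel' hadj := (h.adj_node_iff i₀ hadj.2.1).2 hadj

theorem eventually_exists_node (h : S.IsCoding M m E) (i₀ : ι) (x : CoverNode 1 (S.blowUp i₀ M)) :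
    ∀ᶠ n in atTop, ∃ w : List ι, w.length = n ∧ h.node i₀ w = x := by
  obtain ⟨w, hw⟩ := (h.exists_nodeIndex_iff i₀ x.1).1 x.2
  filter_upwards [eventually_ge_atTop w.length] with n hn
  exact ⟨List.replicate (n - w.length) i₀ ++ w, by simp; omega,
    (h.node_append i₀ _ w).trans (Subtype.ext hw)⟩

/-! ### Growth of the balls of the infinite adjoint graph -/

theorem ncard_neighborhood_le [Finite ι] (h : S.IsCoding M m E) (i₀ : ι)
    (x : CoverNode 1 (S.blowUp i₀ M)) {k j : ℕ} (hk : k ≤ m ^ j) :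
    (neighborhood (S.adjointGraph i₀ M) k x).ncard ≤ 3 ^ p * Nat.card ι ^ j := by
  have hfin : (neighborhood (S.adjointGraph i₀ M) k x).Finite :=
    neighborhood_coverGraph_finite one_pos k x
  set B := neighborhood (S.adjointGraph i₀ M) k x with hB
  -- The ball is finite, so all its nodes can be written as words of one common length `L`, which
  -- may be taken at least `j`.
  have hev : ∀ᶠ n in atTop, ∀ y ∈ B, ∃ w : List ι, w.length = n ∧ h.node i₀ w = y :=
    (Filter.eventually_all_finite hfin).2 fun y _ => h.eventually_exists_node i₀ y
  obtain ⟨L, hL, hjL⟩ := (hev.and (eventually_ge_atTop j)).exists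
  have hm : (0 : ℤ) < (m ^ j : ℕ) := by have := h.two_le; positivity
  -- The index of the block of side `m ^ j` that contains `x`. The first `L - j` letters of a node
  -- in the ball give a block adjacent or equal to it.
  set b : Fin p → ℤ := fun a => E (List.replicate L i₀) x.1 a / (m ^ j : ℕ) with hb
  have hsplit : ∀ y : B, ∃ u v : List ι, v.length = j ∧ u.length = L - j ∧
      h.node i₀ (u ++ v) = y ∧ E u 0 ∈ Finset.Icc (b - 1) (b + 1) := by
    rintro ⟨y, hy⟩
    obtain ⟨w, hw, rfl⟩ := hL y hy
    have hu : (w.take (L - j)).length = L - j := by simp [hw]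
    have hv : (w.drop (L - j)).length = j := by simp [hw]; omega
    refine ⟨w.take (L - j), w.drop (L - j), hv, hu, by rw [List.take_append_drop], ?_⟩
    have hd := h.cell_ediv (w.take (L - j)) (w.drop (L - j))
    rw [List.take_append_drop, hv] at hd
    have hdist : ∀ a, |E w 0 a - E (List.replicate L i₀) x.1 a| ≤ k := fun a => by
      have := abs_sub_le_of_mem_neighborhood one_pos (e := E (List.replicate L i₀))
        (fun z z' => (h.touch_iff _ z z').2) hy a
      rwa [show E (List.replicate L i₀) (h.node i₀ w).1 = E w 0 by
        rw [← hw]; exact apply_nodeIndex i₀ w] at this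
    have hk' : (k : ℤ) ≤ (m ^ j : ℕ) := by exact_mod_cast hk
    have hdist' : ∀ a, b a - 1 ≤ E (w.take (L - j)) 0 a ∧ E (w.take (L - j)) 0 a ≤ b a + 1 := by
      intro a
      have h1 := abs_le.1 (hdist a)
      rw [hd a, hb]
      constructor
      · rw [Int.le_ediv_iff_mul_le hm, sub_mul, one_mul]
        have := Int.ediv_mul_le (E (List.replicate L i₀) x.1 a) hm.ne'
        linarith [h1.1]
      · rw [← Int.add_mul_ediv_right _ _ hm.ne']
        exact Int.ediv_le_ediv hm (by linarith [h1.2])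
    exact Finset.mem_Icc.2 ⟨fun a => (hdist' a).1, fun a => (hdist' a).2⟩
  choose u v hv hu huv hmem using hsplit
  let f : B → Finset.Icc (b - 1) (b + 1) × List.Vector ι j :=
    fun y => (⟨E (u y) 0, hmem y⟩, ⟨v y, hv y⟩)
  have hf : Function.Injective f := by
    intro y y' heq
    have h1 : E (u y) 0 = E (u y') 0 := congrArg (fun t => (t.1 : Fin p → ℤ)) heq
    have h2 : v y = v y' := congrArg (fun t => t.2.1) heq
    have h3 := h.inj _ _ ((hu y).trans (hu y').symm) h1
    exact Subtype.ext (by rw [← huv y, ← huv y', h2, h3])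
  have hcard := Nat.card_le_card_of_injective f hf
  rwa [Nat.card_prod, natCard_vector, Nat.card_coe_set_eq, Nat.card_eq_fintype_card,
    Fintype.card_coe, card_Icc_sub_add_one] at hcard

/-- Each bond between `u` and `v` is inherited by some `u ++ [i]` and `v ++ [j]`, and this inherited
bond itself shows that `i` and `j` are marginal. The path from `u ++ [i₀]` through it to `v ++ [i₀]`
has length at most `r + 1 + r = m`. -/
theorem mem_neighborhood_append (h : S.IsCoding M m E) {i₀ : ι} {r : ℕ} (hm : m = 2 * r + 1)
    (hinh : ∀ u v, (wordGraph E).Adj u v → ∃ i j, (wordGraph E).Adj (u ++ [i]) (v ++ [j]))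
    (hmarg : ∀ i, IsMarginalLetter E i → [i] ∈ neighborhood (wordGraph E) r [i₀])
    {k : ℕ} {u v : List ι} (huv : v ∈ neighborhood (wordGraph E) k u) :
    v ++ [i₀] ∈ neighborhood (wordGraph E) (m * k) (u ++ [i₀]) := by
  refine mem_neighborhood_of_adj (f := fun w => w ++ [i₀]) ?_ huv
  intro u v hadj
  obtain ⟨i, j, hij⟩ := hinh u v hadj
  have hi := mem_neighborhood_map (h.prefixHom u)
    (hmarg i ⟨u, v, hadj.2.1, hadj.1, j, hij.2.2⟩)
  have hj := mem_neighborhood_map (h.prefixHom v)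
    (hmarg j ⟨v, u, hadj.2.1.symm, hadj.1.symm, i, hij.symm.2.2⟩)
  have := mem_neighborhood_trans (mem_neighborhood_trans hi (mem_neighborhood_one hij))
    (mem_neighborhood_comm.1 hj)
  exact neighborhood_mono (by omega) _ this

/-- Appending a letter turns a radius `k` into `m * k + d`. The summand `d` on the left of the bound
makes the induction close: `m * k + 2 * d ≤ m * (k + d)` since `m ≥ 2`. -/
theorem mem_neighborhood_replicate (h : S.IsCoding M m E) {i₀ : ι} {r : ℕ} (hm : m = 2 * r + 1)
    (hinh : ∀ u v, (wordGraph E).Adj u v → ∃ i j, (wordGraph E).Adj (u ++ [i]) (v ++ [j]))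
    (hmarg : ∀ i, IsMarginalLetter E i → [i] ∈ neighborhood (wordGraph E) r [i₀])
    {d : ℕ} (hd : ∀ i, [i] ∈ neighborhood (wordGraph E) d [i₀]) (w : List ι) :
    ∃ k, k + d ≤ d * m ^ w.length ∧
      w ∈ neighborhood (wordGraph E) k (List.replicate w.length i₀) := by
  induction w using List.reverseRecOn with
  | nil => exact ⟨0, by simp, mem_neighborhood_self _ _⟩
  | append_singleton w i ih =>
    obtain ⟨k, hk, hmem⟩ := ih
    refine ⟨m * k + d, ?_, ?_⟩
    · have h2 := h.two_le
      have h3 := Nat.mul_le_mul_left m hk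
      have h4 : 2 * d ≤ m * d := Nat.mul_le_mul_right d h2
      rw [List.length_append, List.length_singleton, pow_succ]
      nlinarith
    · have h1 := h.mem_neighborhood_append hm hinh hmarg hmem
      rw [List.length_append, List.length_singleton, List.replicate_succ']
      exact mem_neighborhood_trans h1 (mem_neighborhood_map (h.prefixHom w) (hd i))

theorem le_ncard_neighborhood [Finite ι] (h : S.IsCoding M m E) {i₀ : ι} {d : ℕ}
    (hball : ∀ w : List ι, w ∈ neighborhood (wordGraph E) (d * m ^ w.length)
      (List.replicate w.length i₀)) {x : CoverNode 1 (S.blowUp i₀ M)} {d' : ℕ}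
    (hx : h.node i₀ [] ∈ neighborhood (S.adjointGraph i₀ M) d' x) {k j : ℕ}
    (hk : (d' + d) * m ^ j ≤ k) :
    Nat.card ι ^ j ≤ (neighborhood (S.adjointGraph i₀ M) k x).ncard := by
  have hfin : Finite (neighborhood (S.adjointGraph i₀ M) k x) :=
    neighborhood_coverGraph_finite one_pos k x
  have hmem : ∀ w : List.Vector ι j, h.node i₀ w.1 ∈ neighborhood (S.adjointGraph i₀ M) k x := by
    rintro ⟨w, rfl⟩
    have h1 := mem_neighborhood_map (h.nodeHom i₀) (hball w)
    change h.node i₀ w ∈ neighborhood _ _ (h.node i₀ _) at h1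
    rw [h.node_replicate] at h1
    refine neighborhood_mono ?_ _ (mem_neighborhood_trans hx h1)
    have : 1 ≤ m ^ w.length := Nat.one_le_pow _ _ (by have := h.two_le; omega)
    nlinarith
  let f : List.Vector ι j → neighborhood (S.adjointGraph i₀ M) k x := fun w => ⟨_, hmem w⟩
  have hf : Function.Injective f := fun w w' heq =>
    Subtype.ext (h.node_inj i₀ (w.2.trans w'.2.symm) (congrArg Subtype.val heq))
  have hcard := Nat.card_le_card_of_injective f hf
  rwa [natCard_vector, Nat.card_coe_set_eq] at hcard

/-- If the infinite adjoint graph is connected and all marginal letters are connected to `i₀`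
within the generator, then so are all letters. -/
theorem reachable_of_adjointGraph (h : S.IsCoding M m E) {i₀ : ι}
    (hconn : (S.adjointGraph i₀ M).Connected)
    (hmarg : ∀ i, IsMarginalLetter E i → (wordGraph E).Reachable [i₀] [i]) (i : ι) :
    (wordGraph E).Reachable [i₀] [i] := by
  -- A walk that starts in the base copy of the generator is followed until it reaches `[i₀]` or
  -- leaves the copy. On leaving, its bond is an outer one, so the current letter is marginal.
  suffices ∀ x y : CoverNode 1 (S.blowUp i₀ M), (S.adjointGraph i₀ M).Walk x y →
      y = h.node i₀ [i₀] → ∀ i, x = h.node i₀ [i] → (wordGraph E).Reachable [i₀] [i] by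
    obtain ⟨q⟩ := hconn.preconnected (h.node i₀ [i]) (h.node i₀ [i₀])
    exact this _ _ q rfl i rfl
  intro x y q hy
  induction q with
  | nil =>
    intro i hi
    rw [h.node_inj i₀ (w := [i₀]) (w' := [i]) rfl (hy.symm.trans hi)]
  | @cons x x' y hadj q ih =>
    rintro i rfl
    by_cases hx' : ∃ j, x' = h.node i₀ [j]
    · obtain ⟨j, rfl⟩ := hx'
      have := (h.adj_node_iff i₀ (w := [i]) (w' := [j]) rfl).1 hadj
      exact (ih hy j rfl).trans this.symm.reachable
    · refine hmarg i ?_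
      obtain ⟨n, ⟨w', hw', rfl⟩, hn⟩ :=
        ((h.eventually_exists_node i₀ x').and (eventually_ge_atTop 1)).exists
      obtain ⟨n, rfl⟩ := Nat.exists_eq_add_of_le' hn
      have hne : w' ≠ [] := fun hh => by simp [hh] at hw'
      obtain ⟨w, j, rfl⟩ : ∃ w j, w' = w ++ [j] :=
        ⟨_, _, (List.dropLast_append_getLast hne).symm⟩
      have hw : w.length = n := by simpa using hw'
      -- To compare the two nodes, `[i]` is padded with `n` letters `i₀` to the same length. Were
      -- `w` the same prefix, the second node would lie in the base copy.
      rw [← h.node_append i₀ n [i], h.adj_node_iff i₀ (by simp [hw])] at hadj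
      refine ⟨List.replicate n i₀, w, by simp [hw], ?_, j, hadj.2.2⟩
      rintro rfl
      exact hx' ⟨j, h.node_append i₀ n [j]⟩

end IsCoding

end SimilaritySystem

/-! ### Growth exponents -/

/-- With `D = ln N / ln m`, the choices `j ≈ log_m g` from above and `j ≈ log_m (g / C)` from below
give `|ln F - D ln g| ≤ K` for a constant `K`; dividing by `ln g → ∞` finishes. The form serves both
radii `n → ∞` and inverse scales `δ⁻¹ → ∞`. -/
theorem tendsto_log_div_log_of_geometric {α : Type*} {l : Filter α} {g F : α → ℝ}
    (hg : Tendsto g l atTop) {N m C : ℝ} (hN : 1 ≤ N) (hm : 1 < m) (hC : 1 ≤ C)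
    (hup : ∀ᶠ a in l, ∀ j : ℕ, g a ≤ m ^ j → F a ≤ C * N ^ j)
    (hlow : ∀ᶠ a in l, ∀ j : ℕ, C * m ^ j ≤ g a → N ^ j ≤ C * F a) :
    Tendsto (fun a => Real.log (F a) / Real.log (g a)) l (𝓝 (Real.log N / Real.log m)) := by
  have hlogm : 0 < Real.log m := Real.log_pos hm
  have hlogN : 0 ≤ Real.log N := Real.log_nonneg hN
  have hlogC : 0 ≤ Real.log C := Real.log_nonneg hC
  have hm0 : 0 < m := by linarith
  have hN0 : 0 < N := by linarith
  have hC0 : 0 < C := by linarith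
  set D := Real.log N / Real.log m with hD
  have hD0 : 0 ≤ D := div_nonneg hlogN hlogm.le
  have hDm : D * Real.log m = Real.log N := div_mul_cancel₀ _ hlogm.ne'
  set K := Real.log C + Real.log N + D * Real.log C with hK
  have hlog : Tendsto (fun a => Real.log (g a)) l atTop := Real.tendsto_log_atTop.comp hg
  have hbound : ∀ᶠ a in l,
      ‖Real.log (F a) / Real.log (g a) - D‖ ≤ K / Real.log (g a) := by
    filter_upwards [hup, hlow, hg.eventually_ge_atTop C, hlog.eventually_gt_atTop 0]
      with a hup hlow hgC hL
    have hg0 : 0 < g a := hC0.trans_le hgC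
    have hLC : Real.log C ≤ Real.log (g a) := Real.log_le_log hC0 hgC
    have hF : 0 < F a := by
      have := hlow 0 (by simpa using hgC)
      rw [pow_zero] at this
      exact pos_of_mul_pos_right (by linarith) hC0.le
    have h1 : Real.log (F a) ≤ D * Real.log (g a) + K := by
      set j := ⌈Real.log (g a) / Real.log m⌉₊
      have hj1 : Real.log (g a) ≤ j * Real.log m := by
        rw [← div_le_iff₀ hlogm]; exact Nat.le_ceil _
      have hj2 : (j : ℝ) * Real.log m ≤ Real.log (g a) + Real.log m := by
        have := (Nat.ceil_lt_add_one (div_nonneg hL.le hlogm.le)).le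
        have := mul_le_mul_of_nonneg_right this hlogm.le
        rwa [add_mul, one_mul, div_mul_cancel₀ _ hlogm.ne'] at this
      have h2 := hup j ((Real.log_le_log_iff hg0 (pow_pos hm0 j)).1 (by rwa [Real.log_pow]))
      have h3 := Real.log_le_log hF h2
      rw [Real.log_mul hC0.ne' (pow_pos hN0 j).ne', Real.log_pow, ← hDm] at h3
      have h4 := mul_le_mul_of_nonneg_left hj2 hD0
      have h5 := mul_nonneg hD0 hlogC
      rw [hK, ← hDm]
      linarith
    have h2 : D * Real.log (g a) - K ≤ Real.log (F a) := by
      set j := ⌊(Real.log (g a) - Real.log C) / Real.log m⌋₊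
      have hj1 : (j : ℝ) * Real.log m ≤ Real.log (g a) - Real.log C := by
        rw [← le_div_iff₀ hlogm]; exact Nat.floor_le (div_nonneg (by linarith) hlogm.le)
      have hj2 : Real.log (g a) - Real.log C - Real.log m ≤ (j : ℝ) * Real.log m := by
        have := (Nat.lt_floor_add_one ((Real.log (g a) - Real.log C) / Real.log m)).le
        have := mul_le_mul_of_nonneg_right this hlogm.le
        rw [add_mul, one_mul, div_mul_cancel₀ _ hlogm.ne'] at this
        linarith
      have h2 := hlow j ((Real.log_le_log_iff (mul_pos hC0 (pow_pos hm0 j)) hg0).1 (by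
        rw [Real.log_mul hC0.ne' (pow_pos hm0 j).ne', Real.log_pow]; linarith))
      have h3 := Real.log_le_log (pow_pos hN0 j) h2
      rw [Real.log_mul hC0.ne' hF.ne', Real.log_pow, ← hDm] at h3
      have h4 := mul_le_mul_of_nonneg_left hj2 hD0
      rw [hK, ← hDm]
      linarith
    have : Real.log (F a) / Real.log (g a) - D =
        (Real.log (F a) - D * Real.log (g a)) / Real.log (g a) := by field_simp
    rw [this, norm_div, Real.norm_of_nonneg hL.le, Real.norm_eq_abs]
    exact div_le_div_of_nonneg_right (abs_le.2 ⟨by linarith, by linarith⟩) hL.le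
  rw [tendsto_iff_norm_sub_tendsto_zero]
  exact squeeze_zero' (Eventually.of_forall fun _ => norm_nonneg _) hbound
    (hlog.const_div_atTop K)

/-! ### Comparison of lattices with different edge lengths -/

theorem finite_and_ncard_le_of_near {p : ℕ} {α : Type*} [Finite α] {B : Set (Fin p → ℤ)}
    (b : α → Fin p → ℤ) (h : ∀ z ∈ B, ∃ w, ∀ a, |z a - b w a| ≤ 1) :
    B.Finite ∧ B.ncard ≤ 3 ^ p * Nat.card α := by
  classical
  have : Fintype α := Fintype.ofFinite α
  set T := (Finset.univ : Finset α).biUnion fun w => Finset.Icc (b w - 1) (b w + 1)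
  have hsub : B ⊆ T := by
    intro z hz
    obtain ⟨w, hw⟩ := h z hz
    refine Finset.mem_coe.2 (Finset.mem_biUnion.2 ⟨w, Finset.mem_univ _, Finset.mem_Icc.2 ?_⟩)
    refine ⟨fun a => ?_, fun a => ?_⟩ <;> have := abs_le.1 (hw a) <;> simp <;> omega
  refine ⟨T.finite_toSet.subset hsub, (Set.ncard_le_ncard hsub T.finite_toSet).trans ?_⟩
  rw [Set.ncard_coe_finset, Nat.card_eq_fintype_card, mul_comm]
  exact Finset.card_biUnion_le_card_mul _ _ _ fun w _ => (card_Icc_sub_add_one _).le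

/-- The lower corner of a cube that is not larger lies within one coarse edge length of the coarse
cube in every coordinate. So a small cube meets at most `3 ^ p` coarse ones, all near its rounded
corner. -/
theorem abs_sub_floor_le_of_mem {p : ℕ} {δ δ' : ℝ} (hδ' : 0 < δ') (hle : δ ≤ δ')
    {z z' : Fin p → ℤ} {x : EuclideanSpace ℝ (Fin p)} (hx : x ∈ closedCube δ z)
    (hx' : x ∈ closedCube δ' z') (a : Fin p) : |z' a - ⌊δ * z a / δ'⌋| ≤ 1 := by
  have h1 := hx a
  have h2 := hx' a
  have e : δ * (z a : ℝ) = δ' * (δ * z a / δ') := by field_simp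
  have h3 : (z' a : ℝ) ≤ δ * z a / δ' + 1 := by
    refine le_of_mul_le_mul_left ?_ hδ'
    rw [mul_add, ← e]
    linarith
  have h4 : δ * z a / δ' ≤ z' a + 1 := by
    refine le_of_mul_le_mul_left ?_ hδ'
    rw [← e]
    linarith
  have h5 : z' a - 1 ≤ ⌊δ * z a / δ'⌋ := Int.le_floor.2 (by push_cast; linarith)
  have h6 : ⌊δ * z a / δ'⌋ ≤ z' a + 1 := by
    have := (Int.floor_le (δ * z a / δ')).trans h4
    exact_mod_cast this
  rw [abs_le]
  constructor <;> linarith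

theorem exists_mem_closedCube {p : ℕ} {δ : ℝ} (hδ : 0 < δ) (x : EuclideanSpace ℝ (Fin p)) :
    ∃ z, x ∈ closedCube δ z := by
  refine ⟨fun a => ⌊x a / δ⌋, fun a => ?_⟩
  have h1 := mul_le_mul_of_nonneg_left (Int.floor_le (x a / δ)) hδ.le
  have h2 := mul_le_mul_of_nonneg_left (Int.lt_floor_add_one (x a / δ)).le hδ.le
  rw [mul_div_cancel₀ _ hδ.ne'] at h1 h2
  exact ⟨h1, h2⟩

/-! ### Box counts and the two dimensions -/

namespace SimilaritySystem

variable {p : ℕ} {ι : Type*} {S : SimilaritySystem p ι} {M : Set (EuclideanSpace ℝ (Fin p))}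

namespace IsCoding

variable {m : ℕ} {E : List ι → (Fin p → ℤ) ≃ (Fin p → ℤ)}

theorem finite_box_and_boxCount_le [Finite ι] (h : S.IsCoding M m E) {δ : ℝ} (hδ : 0 < δ) {n : ℕ}
    (hn : S.ratio ^ n ≤ δ) :
    {z : Fin p → ℤ | (closedCube δ z ∩ M).Nonempty}.Finite ∧
      boxCount δ M ≤ 3 ^ p * Nat.card ι ^ n := by
  rw [← natCard_vector]
  refine finite_and_ncard_le_of_near
    (fun (w : List.Vector ι n) a => ⌊S.ratio ^ n * E w.1 0 a / δ⌋) ?_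
  rintro z ⟨x, hxz, hxM⟩
  obtain ⟨w, hw, hx⟩ := h.exists_mem n x hxM
  exact ⟨⟨w, hw⟩, abs_sub_floor_le_of_mem hδ hn hx hxz⟩

theorem le_boxCount [Finite ι] (h : S.IsCoding M m E) {δ : ℝ} (hδ : 0 < δ) {n : ℕ}
    (hn : δ ≤ S.ratio ^ n) : Nat.card ι ^ n ≤ 3 ^ p * boxCount δ M := by
  have hr1 : S.ratio < 1 := by
    have := h.two_le
    rw [h.ratio_eq]
    exact inv_lt_one_of_one_lt₀ (by exact_mod_cast this)
  -- The upper bound at a sufficiently fine level supplies the finiteness of the set of boxes,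
  -- without which `ncard` would be the default value 0.
  obtain ⟨k, hk⟩ := exists_pow_lt_of_lt_one hδ hr1
  have hfin := (h.finite_box_and_boxCount_le hδ hk.le).1
  have : Finite {z : Fin p → ℤ | (closedCube δ z ∩ M).Nonempty} := hfin
  have key := finite_and_ncard_le_of_near (B := Set.range fun w : List.Vector ι n => E w.1 0)
    (fun (z : {z : Fin p → ℤ | (closedCube δ z ∩ M).Nonempty}) a =>
      ⌊δ * z.1 a / S.ratio ^ n⌋) ?_
  · have hinj : Function.Injective fun w : List.Vector ι n => E w.1 0 := fun w w' hh =>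
      Subtype.ext (h.inj _ _ (w.2.trans w'.2.symm) hh)
    have h2 := key.2
    rw [← Nat.card_coe_set_eq, Nat.card_range_of_injective hinj, natCard_vector,
      Nat.card_coe_set_eq] at h2
    exact h2
  · rintro _ ⟨w, rfl⟩
    obtain ⟨x, hxw, hxM⟩ := (h.mem_iff n (E w.1 0)).2 ⟨w.1, w.2, rfl⟩
    obtain ⟨z, hz⟩ := exists_mem_closedCube hδ x
    exact ⟨⟨z, x, hz, hxM⟩, abs_sub_floor_le_of_mem (pow_pos h.ratio_pos n) hn hz
      (openCube_subset_closedCube _ _ hxw)⟩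

theorem one_le_card [Finite ι] (i₀ : ι) : (1 : ℝ) ≤ Nat.card ι := by
  have : Nonempty ι := ⟨i₀⟩
  exact_mod_cast Nat.card_pos (α := ι)

theorem one_lt (h : S.IsCoding M m E) : (1 : ℝ) < m := by
  have := h.two_le
  exact_mod_cast this

theorem hasBoxDimension [Finite ι] (h : S.IsCoding M m E) (i₀ : ι) :
    HasBoxDimension M (Real.log (Nat.card ι) / Real.log m) := by
  refine ⟨h.isSelfSimilarSet.2.1, ?_⟩
  have hpow : ∀ n : ℕ, S.ratio ^ n = ((m : ℝ) ^ n)⁻¹ := fun n => by rw [h.ratio_eq, inv_pow]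
  have hm0 : ∀ n : ℕ, (0 : ℝ) < (m : ℝ) ^ n := fun n => pow_pos (by linarith [h.one_lt]) n
  have hC : (1 : ℝ) ≤ 3 ^ p := one_le_pow₀ (by norm_num)
  have := tendsto_log_div_log_of_geometric (l := 𝓝[>] (0 : ℝ)) (g := fun δ => δ⁻¹)
    (F := fun δ => (boxCount δ M : ℝ)) tendsto_inv_nhdsGT_zero (one_le_card i₀) h.one_lt hC
    (by
      filter_upwards [self_mem_nhdsWithin] with δ (hδ : 0 < δ) j hj
      have := (h.finite_box_and_boxCount_le hδ (n := j)
        (by rw [hpow]; exact inv_le_of_inv_le₀ hδ hj)).2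
      exact_mod_cast this)
    (by
      filter_upwards [self_mem_nhdsWithin] with δ (hδ : 0 < δ) j hj
      have := h.le_boxCount hδ (n := j)
        (by
          rw [hpow]
          refine le_inv_of_le_inv₀ (hm0 j) (le_trans ?_ hj)
          exact le_mul_of_one_le_left (hm0 j).le hC)
      exact_mod_cast this)
  simpa only [Real.log_inv] using this

theorem hasInternalScalingDimension [Finite ι] (h : S.IsCoding M m E) {i₀ : ι} {r : ℕ}
    (hm : m = 2 * r + 1)
    (hinh : ∀ u v, (wordGraph E).Adj u v → ∃ i j, (wordGraph E).Adj (u ++ [i]) (v ++ [j]))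
    (hmarg : ∀ i, IsMarginalLetter E i → [i] ∈ neighborhood (wordGraph E) r [i₀])
    (hconn : ∀ i, (wordGraph E).Reachable [i₀] [i]) :
    HasInternalScalingDimension (S.adjointGraph i₀ M)
      (Real.log (Nat.card ι) / Real.log m) := by
  choose k hk using fun i => exists_mem_neighborhood (hconn i)
  obtain ⟨d, hd⟩ := (Set.finite_range k).bddAbove
  have hd' : ∀ i, [i] ∈ neighborhood (wordGraph E) d [i₀] := fun i =>
    neighborhood_mono (hd ⟨i, rfl⟩) _ (hk i)
  have hball : ∀ w : List ι, w ∈ neighborhood (wordGraph E) (d * m ^ w.length)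
      (List.replicate w.length i₀) := fun w => by
    obtain ⟨k, hk, hw⟩ := h.mem_neighborhood_replicate hm hinh hmarg hd' w
    exact neighborhood_mono (by omega) _ hw
  intro x
  refine ⟨fun n => neighborhood_coverGraph_finite one_pos n x, ?_⟩
  obtain ⟨d', hx⟩ : ∃ d', h.node i₀ [] ∈ neighborhood (S.adjointGraph i₀ M) d' x := by
    obtain ⟨n, w, rfl, rfl⟩ := (h.eventually_exists_node i₀ x).exists
    have h1 := mem_neighborhood_map (h.nodeHom i₀) (hball w)
    change h.node i₀ w ∈ neighborhood _ _ (h.node i₀ _) at h1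
    rw [h.node_replicate] at h1
    exact ⟨_, mem_neighborhood_comm.1 h1⟩
  have h3 : (1 : ℝ) ≤ 3 ^ p := one_le_pow₀ (by norm_num)
  -- One constant for both estimates: `3 ^ p` from the upper bound, `d' + d` from the lower one,
  -- where `d'` bounds the distance from `x` to the base node.
  have hC : (1 : ℝ) ≤ 3 ^ p + (d' + d : ℕ) := by
    have : (0 : ℝ) ≤ (d' + d : ℕ) := Nat.cast_nonneg _
    linarith
  refine tendsto_log_div_log_of_geometric (g := fun n : ℕ => (n : ℝ))
    (F := fun n => ((neighborhood (S.adjointGraph i₀ M) n x).ncard : ℝ))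
    tendsto_natCast_atTop_atTop (one_le_card i₀) h.one_lt hC ?_ ?_
  · refine Eventually.of_forall fun n j hj => ?_
    have := h.ncard_neighborhood_le i₀ x (k := n) (j := j) (by exact_mod_cast hj)
    have : ((neighborhood (S.adjointGraph i₀ M) n x).ncard : ℝ) ≤
        3 ^ p * (Nat.card ι : ℝ) ^ j := by exact_mod_cast this
    refine this.trans (mul_le_mul_of_nonneg_right ?_ (by positivity))
    exact le_add_of_nonneg_right (Nat.cast_nonneg _)
  · refine Eventually.of_forall fun n j hj => ?_
    have hle : ((d' + d : ℕ) : ℝ) * (m : ℝ) ^ j ≤ n :=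
      (mul_le_mul_of_nonneg_right (by linarith) (by positivity)).trans hj
    have := h.le_ncard_neighborhood hball hx (k := n) (j := j) (by exact_mod_cast hle)
    have : (Nat.card ι : ℝ) ^ j ≤ ((neighborhood (S.adjointGraph i₀ M) n x).ncard : ℝ) := by
      exact_mod_cast this
    exact this.trans (le_mul_of_one_le_left (Nat.cast_nonneg _) hC)

/-! ### The hypotheses in terms of words -/

/-- The cubes of a construction step as words. -/
def stepHom (h : S.IsCoding M m E) (n : ℕ) : S.stepGraph M n →g wordGraph E where
  toFun z := ((h.mem_iff n z.1).1 z.2).choose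
  map_rel' := fun {z z'} hadj => by
    have h1 := ((h.mem_iff n z.1).1 z.2).choose_spec
    have h2 := ((h.mem_iff n z'.1).1 z'.2).choose_spec
    obtain ⟨hne, ht⟩ := (coverGraph_adj_iff (pow_pos h.ratio_pos n) z z').1 hadj
    refine ⟨fun hh => hne (Subtype.ext ?_), h1.1.trans h2.1.symm, ?_⟩
    · rw [← h1.2, ← h2.2, hh]
    · rwa [h1.2, h2.2]

theorem stepHom_apply (h : S.IsCoding M m E) {n : ℕ} (z : S.StepNode M n) {w : List ι}
    (hlen : w.length = n) (hw : E w 0 = z.1) : h.stepHom n z = w := by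
  have h1 := ((h.mem_iff n z.1).1 z.2).choose_spec
  exact h.inj _ _ (h1.1.trans hlen.symm) (h1.2.trans hw.symm)

theorem isNodeOf_iff (h : S.IsCoding M m E) (v : S.StepNode M 1) (i : ι) :
    S.IsNodeOf M v i ↔ E [i] 0 = v.1 := by
  have himg : S.map i '' openCube 1 0 = openCube (S.ratio ^ 1) (E [i] 0) := by
    ext y
    obtain ⟨x, rfl⟩ := (map_bijective h.ratio_pos i).2 y
    rw [(map_bijective h.ratio_pos i).1.mem_set_image]
    exact (h.isCubeMap [i] 0 x).1.symm
  rw [IsNodeOf, himg]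
  exact ⟨fun hh => openCube_inj (pow_pos h.ratio_pos 1) hh.subset, fun hh => by rw [hh]⟩

theorem wordMap_image_closedCube (h : S.IsCoding M m E) (w : List ι) (i : ι) :
    S.wordMap w '' (S.map i '' closedCube 1 0) =
      closedCube (S.ratio ^ (w.length + 1)) (E (w ++ [i]) 0) := by
  rw [Set.image_image]
  ext y
  obtain ⟨x, rfl⟩ := (wordMap_bijective h.ratio_pos (w ++ [i])).2 y
  have h1 := (h.isCubeMap (w ++ [i]) 0 x).2
  rw [List.length_append, List.length_singleton] at h1
  rw [h1, wordMap_append, wordMap_singleton]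
  exact ((wordMap_bijective h.ratio_pos w).comp (map_bijective h.ratio_pos i)).1.mem_set_image

theorem exists_adj_append (h : S.IsCoding M m E) (hb : S.BondsAreInherited M) (u v : List ι)
    (hadj : (wordGraph E).Adj u v) : ∃ i j, (wordGraph E).Adj (u ++ [i]) (v ++ [j]) := by
  obtain ⟨hne, hlen, ht⟩ := hadj
  let un : S.StepNode M u.length := ⟨E u 0, (h.mem_iff _ _).2 ⟨u, rfl, rfl⟩⟩
  let vn : S.StepNode M u.length := ⟨E v 0, (h.mem_iff _ _).2 ⟨v, hlen.symm, rfl⟩⟩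
  obtain ⟨u', v', hu, hv, hadj'⟩ := hb u.length un vn
    ((coverGraph_adj_iff (pow_pos h.ratio_pos _) _ _).2
      ⟨fun hh => hne (h.inj _ _ hlen (congrArg Subtype.val hh)), ht⟩)
  -- Containment of cubes becomes the prefix relation: dropping the last letter of the word of `z`
  -- gives the unique word of length `|u|` whose cell contains `z`.
  have key : ∀ (w : List ι) (z : S.StepNode M (u.length + 1)), w.length = u.length →
      openCube (S.ratio ^ (u.length + 1)) z.1 ⊆ openCube (S.ratio ^ u.length) (E w 0) →
      ∃ i, h.stepHom _ z = w ++ [i] := by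
    intro w z hw hsub
    obtain ⟨w', hw', hz⟩ := (h.mem_iff _ _).1 z.2
    have hne : w' ≠ [] := fun hh => by simp [hh] at hw'
    obtain ⟨w₁, i, rfl⟩ : ∃ w₁ i, w' = w₁ ++ [i] :=
      ⟨_, _, (List.dropLast_append_getLast hne).symm⟩
    have hw₁ : w₁.length = u.length := by simpa using hw'
    have h1 := h.wordMap_center_mem (w₁ ++ [i])
    rw [hw', hz] at h1
    have h2 := (h.isCubeMap w₁ 0 _).1.2 (h.wordMap_mem [i] _ (cubeCenter_mem p))
    rw [← wordMap_append, hw₁] at h2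
    have h3 := eq_of_openCube_inter_closedCube (pow_pos h.ratio_pos _) h2
      (openCube_subset_closedCube _ _ (hsub h1))
    rw [← h.inj _ _ (hw₁.trans hw.symm) h3]
    exact ⟨i, h.stepHom_apply z hw' hz⟩
  obtain ⟨i, hi⟩ := key u u' rfl hu
  obtain ⟨j, hj⟩ := key v v' hlen.symm hv
  refine ⟨i, j, ?_⟩
  rw [← hi, ← hj]
  exact (h.stepHom _).map_adj hadj'

theorem mem_neighborhood_of_isMarginalLetter (h : S.IsCoding M m E) {r : ℕ}
    {x₀ : S.StepNode M 1} {i₀ : ι} (hx₀ : S.IsNodeOf M x₀ i₀)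
    (hr : ∀ v : S.StepNode M 1, S.IsMarginal M v → (S.stepGraph M 1).edist x₀ v = (r : ℕ∞))
    (i : ι) (hi : IsMarginalLetter E i) : [i] ∈ neighborhood (wordGraph E) r [i₀] := by
  let v : S.StepNode M 1 := ⟨E [i] 0, (h.mem_iff _ _).2 ⟨[i], rfl, rfl⟩⟩
  obtain ⟨w, w', hlen, hne, j, ht⟩ := hi
  have hv : S.IsMarginal M v := by
    refine ⟨i, (h.isNodeOf_iff v i).2 rfl, w, w', hlen, hne, j, ?_⟩
    rw [h.wordMap_image_closedCube, h.wordMap_image_closedCube, hlen]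
    exact (closedCube_inter_nonempty_iff (pow_pos h.ratio_pos _) _ _).2 ht
  have := mem_neighborhood_map (h.stepHom 1) (show v ∈ neighborhood _ r x₀ from (hr v hv).le)
  rwa [h.stepHom_apply x₀ (w := [i₀]) rfl ((h.isNodeOf_iff x₀ i₀).1 hx₀),
    h.stepHom_apply v (w := [i]) rfl rfl] at this

end IsCoding

/-! ### Equality of the dimensions -/

theorem exists_dimension [Finite ι] {r : ℕ} {x₀ : S.StepNode M 1} {i₀ : ι}
    (hc1 : S.ratio < 1) (hr : 2 * (r : ℝ) + 1 = 1 / S.ratio) (hM : S.IsSelfSimilarSet M)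
    (hfit : S.FitsLattice) (hb : S.BondsAreInherited M) (hx₀ : S.IsNodeOf M x₀ i₀)
    (hmarg : ∀ v : S.StepNode M 1, S.IsMarginal M v →
      (S.stepGraph M 1).edist x₀ v = (r : ℕ∞))
    (hconn : (S.adjointGraph i₀ M).Connected) :
    ∃ D : ℝ, HasInternalScalingDimension (S.adjointGraph i₀ M) D ∧ HasBoxDimension M D := by
  have hratio : S.ratio = ((2 * r + 1 : ℕ) : ℝ)⁻¹ := by
    push_cast
    rw [hr, one_div, inv_inv]
  have hr1 : 2 ≤ 2 * r + 1 := by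
    rcases Nat.eq_zero_or_pos r with rfl | hpos
    · simp at hratio; linarith
    · omega
  have hmeet : ∃ i, ∃ x ∈ M, x ∈ S.map i '' openCube 1 0 := by
    obtain ⟨x, hx, hxM⟩ := x₀.2
    exact ⟨i₀, x, hxM, hx₀.symm.subset hx⟩
  obtain ⟨E, hE⟩ := exists_isCoding hr1 hratio hM hfit hmeet
  have hmarg' := hE.mem_neighborhood_of_isMarginalLetter hx₀ hmarg
  have hreach : ∀ i, (wordGraph E).Reachable [i₀] [i] :=
    hE.reachable_of_adjointGraph hconn fun i hi => by
      obtain ⟨q, -⟩ := mem_neighborhood_iff.1 (hmarg' i hi)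
      exact ⟨q⟩
  exact ⟨_, hE.hasInternalScalingDimension rfl (hE.exists_adj_append hb) hmarg' hreach,
    hE.hasBoxDimension i₀⟩

end SimilaritySystem

/-! ### The set generated with the open unit cube -/

theorem isBounded_openCube_one (p : ℕ) : Bornology.IsBounded (openCube 1 (0 : Fin p → ℤ)) := by
  rw [isBounded_iff_forall_norm_le]
  refine ⟨√p, fun x hx => ?_⟩
  rw [EuclideanSpace.norm_eq]
  refine Real.sqrt_le_sqrt ?_
  calc ∑ a, ‖x a‖ ^ 2 ≤ ∑ _a : Fin p, (1 : ℝ) := Finset.sum_le_sum fun a _ => by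
        have := hx a
        simp at this
        rw [Real.norm_of_nonneg this.1.le]
        exact pow_le_one₀ this.1.le this.2.le
    _ = p := by simp

namespace SimilaritySystem

variable {p : ℕ} {ι : Type*} {S : SimilaritySystem p ι}

theorem mem_generatedSet_iff {x : EuclideanSpace ℝ (Fin p)} :
    x ∈ S.generatedSet ↔ ∀ n : ℕ, ∃ w : List ι, w.length = n ∧
      ∃ y ∈ openCube 1 (0 : Fin p → ℤ), S.wordMap w y = x := by
  simp [generatedSet]

theorem generatedSet_eq_iUnion (hc0 : 0 < S.ratio) (hfit : S.FitsLattice) :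
    S.generatedSet = ⋃ i, S.map i '' S.generatedSet := by
  ext x
  rw [Set.mem_iUnion]
  constructor
  · intro hx
    rw [mem_generatedSet_iff] at hx
    have hcons : ∀ n, ∃ i, ∃ w : List ι, w.length = n ∧
        ∃ y ∈ openCube 1 (0 : Fin p → ℤ), S.map i (S.wordMap w y) = x := by
      intro n
      obtain ⟨w, hw, y, hy, rfl⟩ := hx (n + 1)
      cases w with
      | nil => simp at hw
      | cons i w => exact ⟨i, w, by simpa using hw, y, hy, rfl⟩
    obtain ⟨i, w₀, -, y₀, hy₀, hx₀⟩ := hcons 0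
    refine ⟨i, S.wordMap w₀ y₀, mem_generatedSet_iff.2 fun n => ?_, hx₀⟩
    obtain ⟨j, w, hw, y, hy, hxy⟩ := hcons n
    -- Words for different `n` come with unrelated first letters; disjointness of the first-level
    -- cells forces them all to be the same.
    have hij : j = i := by
      by_contra hne
      exact Set.disjoint_left.1 (hfit.2 hne) ⟨_, hfit.wordMap_mem_openCube w hy, hxy⟩
        ⟨_, hfit.wordMap_mem_openCube w₀ hy₀, hx₀⟩
    subst hij
    exact ⟨w, hw, y, hy, (map_bijective hc0 j).1 (hxy.trans hx₀.symm)⟩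
  · rintro ⟨i, x, hx, rfl⟩
    rw [mem_generatedSet_iff] at hx ⊢
    intro n
    cases n with
    | zero =>
      obtain ⟨w, -, y, hy, rfl⟩ := hx 0
      exact ⟨[], rfl, _, hfit.wordMap_mem_openCube (i :: w) hy, rfl⟩
    | succ n =>
      obtain ⟨w, hw, y, hy, rfl⟩ := hx n
      exact ⟨i :: w, by simp [hw], y, hy, rfl⟩

theorem generatedSet_subset : S.generatedSet ⊆ openCube 1 (0 : Fin p → ℤ) := by
  intro x hx
  obtain ⟨w, hw, y, hy, rfl⟩ := mem_generatedSet_iff.1 hx 0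
  rwa [List.length_eq_zero_iff.1 hw]

/-- An intersection of open sets might be empty; a fixed point of one map inside the open cube
survives all steps. -/
theorem isSelfSimilarSet_generatedSet (hc0 : 0 < S.ratio) (hfit : S.FitsLattice) {i : ι}
    {x : EuclideanSpace ℝ (Fin p)} (hx : x ∈ openCube 1 (0 : Fin p → ℤ)) (hix : S.map i x = x) :
    S.IsSelfSimilarSet S.generatedSet := by
  refine ⟨⟨x, mem_generatedSet_iff.2 fun n => ⟨List.replicate n i, by simp, x, hx, ?_⟩⟩,
    (isBounded_openCube_one p).subset generatedSet_subset, generatedSet_eq_iUnion hc0 hfit⟩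
  rw [wordMap_replicate, Function.iterate_fixed hix]

end SimilaritySystem

/-! ### The sponges -/

open SimilaritySystem

/-- The position of a cell of the sponge generator. -/
def spongePos {l : ℕ} (q : SpongeIndex l) : Fin 2 → ℤ := ![(q.1.1 : ℕ), (q.1.2 : ℕ)]

theorem spongePos_injective {l : ℕ} : Function.Injective (spongePos (l := l)) := by
  intro q q' h
  have h0 := congrFun h 0
  have h1 := congrFun h 1
  simp [spongePos] at h0 h1
  exact Subtype.ext (Prod.ext (Fin.ext h0) (Fin.ext h1))

theorem spongePos_bounds {l : ℕ} (q : SpongeIndex l) (a : Fin 2) :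
    0 ≤ spongePos q a ∧ spongePos q a ≤ 2 * l := by
  fin_cases a
  · have := q.1.1.2
    simp [spongePos]
    omega
  · have := q.1.2.2
    simp [spongePos]
    omega

theorem spongeSystem_ratio (l : ℕ) : (spongeSystem l).ratio = ((2 * l + 1 : ℕ) : ℝ)⁻¹ := by
  simp [spongeSystem]

theorem spongeSystem_ratio_pos (l : ℕ) : 0 < (spongeSystem l).ratio := by
  rw [spongeSystem_ratio]; positivity

theorem spongeSystem_ratio_mul (l : ℕ) : (spongeSystem l).ratio * (2 * l + 1) = 1 := by
  have : (2 * (l : ℝ) + 1) ≠ 0 := by positivity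
  rw [spongeSystem_ratio]
  push_cast
  field_simp

theorem spongeSystem_map_apply {l : ℕ} (q : SpongeIndex l) (x : EuclideanSpace ℝ (Fin 2))
    (a : Fin 2) :
    (spongeSystem l).map q x a = (spongeSystem l).ratio * (x a + spongePos q a) := by
  fin_cases a <;> simp [SimilaritySystem.map, spongeSystem, spongePos, mul_add]

theorem spongeSystem_map_mem_openCube_iff {l : ℕ} (q : SpongeIndex l)
    (x : EuclideanSpace ℝ (Fin 2)) :
    (spongeSystem l).map q x ∈ openCube (spongeSystem l).ratio (spongePos q) ↔
      x ∈ openCube 1 (0 : Fin 2 → ℤ) := by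
  refine forall_congr' fun a => ?_
  rw [spongeSystem_map_apply, mul_lt_mul_iff_right₀ (spongeSystem_ratio_pos l),
    mul_lt_mul_iff_right₀ (spongeSystem_ratio_pos l)]
  simp
  intro _
  constructor <;> intro <;> linarith

theorem spongeSystem_fitsLattice (l : ℕ) : (spongeSystem l).FitsLattice := by
  have hc := spongeSystem_ratio_pos l
  have himg : ∀ q : SpongeIndex l, (spongeSystem l).map q '' openCube 1 0 =
      openCube (spongeSystem l).ratio (spongePos q) := by
    intro q
    ext y
    obtain ⟨x, rfl⟩ := (map_bijective hc q).2 y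
    rw [(map_bijective hc q).1.mem_set_image, spongeSystem_map_mem_openCube_iff]
  refine ⟨fun q => ⟨spongePos q, himg q, fun x hx a => ?_⟩, fun q q' hne => ?_⟩
  · have h1 := hx a
    obtain ⟨h2, h3⟩ := spongePos_bounds q a
    have h2 : (0 : ℝ) ≤ spongePos q a := by exact_mod_cast h2
    have h3 : (spongePos q a : ℝ) ≤ 2 * l := by exact_mod_cast h3
    have h4 := mul_le_mul_of_nonneg_left (add_le_add_left h3 1) hc.le
    rw [spongeSystem_ratio_mul] at h4
    have h5 := mul_nonneg hc.le h2
    simp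
    constructor <;> linarith
  · change Disjoint (_ '' _) (_ '' _)
    rw [himg, himg, Set.disjoint_left]
    exact fun x hx hx' => hne (spongePos_injective
      (eq_of_openCube_inter_closedCube hc hx (openCube_subset_closedCube _ _ hx')))

theorem spongePos_center (l : ℕ) (a : Fin 2) : spongePos (spongeCenter l) a = l := by
  fin_cases a <;> simp [spongePos, spongeCenter]

theorem spongeSystem_isSelfSimilarSet_generatedSet (l : ℕ) :
    (spongeSystem l).IsSelfSimilarSet (spongeSystem l).generatedSet := by
  refine isSelfSimilarSet_generatedSet (spongeSystem_ratio_pos l) (spongeSystem_fitsLattice l)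
    (i := spongeCenter l) (cubeCenter_mem 2) ?_
  ext a
  rw [spongeSystem_map_apply, spongePos_center]
  have := spongeSystem_ratio_mul l
  simp [cubeCenter]
  linarith

theorem card_spongeIndex (l : ℕ) : Nat.card (SpongeIndex l) = 2 * l ^ 2 + 2 * l + 1 := by
  have hgeom : ∑ a : Fin (2 * l + 1), (-1 : ℤ) ^ (a : ℕ) = 1 := by
    rw [Fin.sum_univ_eq_sum_range (fun i => (-1 : ℤ) ^ i), neg_one_geom_sum,
      if_neg (by simp)]
  -- Twice the indicator of evenness is `1 + (-1) ^ (a + b)`. The alternating part factors into two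
  -- sums equal to 1, so twice the count is `(2l+1)² + 1`.
  have hcard : (Nat.card (SpongeIndex l) : ℤ) * 2 =
      ∑ q : Fin (2 * l + 1) × Fin (2 * l + 1), (1 + (-1) ^ ((q.1 : ℕ) + (q.2 : ℕ))) := by
    rw [Nat.card_eq_fintype_card, Fintype.card_subtype, Finset.card_filter, Nat.cast_sum,
      Finset.sum_mul]
    refine Finset.sum_congr rfl fun q _ => ?_
    split_ifs with h
    · rw [h.neg_one_pow]; norm_num
    · rw [(Nat.not_even_iff_odd.1 h).neg_one_pow]; norm_num
  rw [Finset.sum_add_distrib, Fintype.sum_prod_type (f := fun q : Fin (2 * l + 1) ×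
    Fin (2 * l + 1) => (-1 : ℤ) ^ ((q.1 : ℕ) + (q.2 : ℕ)))] at hcard
  simp_rw [pow_add] at hcard
  rw [← Finset.sum_mul_sum, hgeom] at hcard
  simp at hcard
  have : (Nat.card (SpongeIndex l) : ℤ) = 2 * l ^ 2 + 2 * l + 1 := by
    rw [Nat.card_eq_fintype_card]
    linarith
  exact_mod_cast this

/-! ### Coordinates, bonds and paths in the sponges -/

section Coding

variable {l : ℕ} {M : Set (EuclideanSpace ℝ (Fin 2))}
  {E : List (SpongeIndex l) → (Fin 2 → ℤ) ≃ (Fin 2 → ℤ)}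

theorem exists_isCoding_spongeSystem (hl : 1 ≤ l) (hM : (spongeSystem l).IsSelfSimilarSet M) :
    ∃ E, (spongeSystem l).IsCoding M (2 * l + 1) E := by
  have hc := spongeSystem_ratio_pos l
  have hl' : (1 : ℝ) ≤ l := by exact_mod_cast hl
  have hmul := spongeSystem_ratio_mul l
  have hc1 : (spongeSystem l).ratio < 1 := by nlinarith
  have hsub := hM.subset_closedCube hc hc1 fun q x hx a => by
    have h1 := hx a
    obtain ⟨h2, h3⟩ := spongePos_bounds q a
    have h2 : (0 : ℝ) ≤ spongePos q a := by exact_mod_cast h2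
    have h3 : (spongePos q a : ℝ) ≤ 2 * l := by exact_mod_cast h3
    simp at h1
    have h4 := mul_le_mul_of_nonneg_left (add_le_add h1.2 h3) hc.le
    have h5 := mul_nonneg hc.le (add_nonneg h1.1 h2)
    rw [spongeSystem_map_apply]
    simp
    constructor <;> linarith
  refine exists_isCoding (by omega) (spongeSystem_ratio l) hM (spongeSystem_fitsLattice l) ?_
  obtain ⟨y, hy⟩ := hM.1
  -- One application of the central map moves a point of the closed unit square into the open one;
  -- the second puts it inside the open central cell.
  refine ⟨spongeCenter l, _, hM.map_mem (spongeCenter l) (hM.map_mem (spongeCenter l) hy), _, ?_,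
    rfl⟩
  intro a
  have h1 := hsub hy a
  rw [spongeSystem_map_apply, spongePos_center]
  simp at h1 ⊢
  constructor
  · exact mul_pos hc (by linarith)
  · calc (spongeSystem l).ratio * (y a + l) < (spongeSystem l).ratio * (2 * l + 1) :=
          mul_lt_mul_of_pos_left (by linarith) hc
      _ = 1 := hmul

theorem spongeSystem_wordMap_apply (h : (spongeSystem l).IsCoding M (2 * l + 1) E)
    (w : List (SpongeIndex l)) (x : EuclideanSpace ℝ (Fin 2)) (a : Fin 2) :
    (spongeSystem l).wordMap w x a = (spongeSystem l).ratio ^ w.length * (x a + E w 0 a) := by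
  have hmul := h.ratio_mul
  obtain ⟨v, hv⟩ : ∃ v : Fin 2 → ℤ, ∀ x a, (spongeSystem l).wordMap w x a =
      (spongeSystem l).ratio ^ w.length * (x a + v a) := by
    induction w with
    | nil => exact ⟨0, fun x a => by simp [wordMap]⟩
    | cons q w ih =>
      obtain ⟨v, hv⟩ := ih
      refine ⟨fun a => v a + (2 * l + 1 : ℕ) ^ w.length * spongePos q a, fun x a => ?_⟩
      have hpow : (spongeSystem l).ratio ^ w.length * ((2 * l + 1 : ℕ) : ℝ) ^ w.length = 1 := by
        rw [← mul_pow, hmul, one_pow]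
      rw [wordMap, Function.comp_apply, spongeSystem_map_apply, hv, List.length_cons, pow_succ']
      simp only [Int.cast_add, Int.cast_mul, Int.cast_pow, Int.cast_natCast]
      linear_combination (-(spongeSystem l).ratio * spongePos q a) * hpow
  have hvE : v = E w 0 := by
    have hc := pow_pos h.ratio_pos w.length
    refine eq_of_openCube_inter_closedCube hc (x := (spongeSystem l).wordMap w (cubeCenter 2)) ?_
      (openCube_subset_closedCube _ _ (h.wordMap_center_mem w))
    intro a
    rw [hv, mul_lt_mul_iff_right₀ hc, mul_lt_mul_iff_right₀ hc]
    norm_num [cubeCenter]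
    linarith
  rw [hv, hvE]

theorem sponge_cell_append (h : (spongeSystem l).IsCoding M (2 * l + 1) E)
    (w : List (SpongeIndex l)) (q : SpongeIndex l) (a : Fin 2) :
    E (w ++ [q]) 0 a = (2 * l + 1) * E w 0 a + spongePos q a := by
  have h1 := spongeSystem_wordMap_apply h (w ++ [q]) 0 a
  rw [wordMap_append, spongeSystem_wordMap_apply h, wordMap_singleton, spongeSystem_map_apply,
    List.length_append, List.length_singleton, pow_succ, mul_assoc] at h1
  have h2 := mul_left_cancel₀ (pow_pos h.ratio_pos w.length).ne' h1
  have hmul := spongeSystem_ratio_mul l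
  have h3 : (E (w ++ [q]) 0 a : ℝ) = (2 * l + 1) * E w 0 a + spongePos q a := by
    refine mul_left_cancel₀ h.ratio_pos.ne' ?_
    simp only [PiLp.zero_apply, zero_add] at h2
    linear_combination -h2 - (E w 0 a : ℝ) * hmul
  exact_mod_cast h3

theorem sponge_cell_singleton (h : (spongeSystem l).IsCoding M (2 * l + 1) E) (q : SpongeIndex l) :
    E [q] 0 = spongePos q := by
  funext a
  have h0 := spongeSystem_wordMap_apply h [] 0 a
  have h1 := sponge_cell_append h [] q a
  have h2 : E [] 0 a = 0 := by
    rw [wordMap, id, PiLp.zero_apply, List.length_nil, pow_zero, one_mul, zero_add] at h0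
    exact Int.cast_eq_zero.1 h0.symm
  rwa [h2, mul_zero, zero_add] at h1

/-- The corner cells of the sponge generator. -/
def spongeCorner (l : ℕ) (s t : Prop) [Decidable s] [Decidable t] : SpongeIndex l :=
  ⟨(if s then ⟨2 * l, by omega⟩ else ⟨0, by omega⟩, if t then ⟨2 * l, by omega⟩ else ⟨0, by omega⟩),
    by split_ifs <;> simp [← two_mul]⟩

theorem spongePos_corner (s : Fin 2 → Prop) [DecidablePred s] (a : Fin 2) :
    spongePos (spongeCorner l (s 0) (s 1)) a = if s a then 2 * l else 0 := by
  fin_cases a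
  · simp only [spongePos, spongeCorner]
    by_cases h : s 0 <;> simp [h]
  · simp only [spongePos, spongeCorner]
    by_cases h : s 1 <;> simp [h]

/-- The facing corner cells touch: where the coordinates of `u` and `v` differ, the smaller one gets
the digit `2l` and the larger one `0`; where they agree, both get `0`. The corners belong to the
pattern, since their coordinates are even. -/
theorem sponge_exists_adj_append (h : (spongeSystem l).IsCoding M (2 * l + 1) E)
    (u v : List (SpongeIndex l)) (hadj : (wordGraph E).Adj u v) :
    ∃ i j, (wordGraph E).Adj (u ++ [i]) (v ++ [j]) := by
  obtain ⟨hne, hlen, ht⟩ := hadj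
  refine ⟨spongeCorner l (E u 0 0 < E v 0 0) (E u 0 1 < E v 0 1),
    spongeCorner l (E v 0 0 < E u 0 0) (E v 0 1 < E u 0 1),
    fun hh => hne (List.append_inj_left' hh rfl), by simp [hlen], fun a => ?_⟩
  rw [sponge_cell_append h, sponge_cell_append h, spongePos_corner (fun a => E u 0 a < E v 0 a),
    spongePos_corner (fun a => E v 0 a < E u 0 a)]
  have h1 := abs_le.1 (ht a)
  rcases lt_trichotomy (E u 0 a) (E v 0 a) with h2 | h2 | h2
  · have h3 : E v 0 a = E u 0 a + 1 := by omega
    rw [if_pos h2, if_neg h2.le.not_gt, h3, abs_le]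
    push_cast
    constructor <;> linarith
  · simp [h2]
  · have h3 : E u 0 a = E v 0 a + 1 := by omega
    rw [if_neg h2.le.not_gt, if_pos h2, h3, abs_le]
    push_cast
    constructor <;> linarith

/-- Moving both coordinates by one preserves parity, so diagonal steps towards the centre stay in
the pattern and reduce the maximum distance. -/
theorem sponge_mem_neighborhood (hl : 1 ≤ l) (h : (spongeSystem l).IsCoding M (2 * l + 1) E)
    (k : ℕ) (q : SpongeIndex l) (hq : ∀ a, |spongePos q a - l| ≤ k) :
    [q] ∈ neighborhood (wordGraph E) k [spongeCenter l] := by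
  by_cases hc : q = spongeCenter l
  · rw [hc]; exact mem_neighborhood_self _ _
  induction k generalizing q with
  | zero =>
    refine absurd (spongePos_injective (funext fun a => ?_)) hc
    rw [spongePos_center]
    have := abs_le.1 (hq a)
    push_cast at this
    omega
  | succ k ih =>
    obtain ⟨⟨⟨a, ha⟩, ⟨b, hb⟩⟩, hab⟩ := q
    have hq0 := abs_le.1 (hq 0)
    have hq1 := abs_le.1 (hq 1)
    simp only [spongePos, Matrix.cons_val_zero, Matrix.cons_val_one, Nat.cast_add,
      Nat.cast_one] at hq0 hq1
    simp only at hab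
    rw [Nat.even_iff] at hab
    have hne : a ≠ l ∨ b ≠ l := by
      by_contra! hh
      exact hc (Subtype.ext (Prod.ext (Fin.ext hh.1) (Fin.ext hh.2)))
    -- A coordinate already equal to `l` moves to `l + 1`. This is harmless for `k ≥ 1`; for `k = 0`
    -- the other coordinate would be `l ± 1`, which parity excludes.
    let q' : SpongeIndex l := ⟨(⟨if l < a then a - 1 else a + 1, by split_ifs <;> omega⟩,
      ⟨if l < b then b - 1 else b + 1, by split_ifs <;> omega⟩), by
        simp only
        rw [Nat.even_iff]
        split_ifs <;> omega⟩
    have hq' : ∀ c, |spongePos q' c - l| ≤ k := by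
      intro c
      rw [abs_le]
      revert c
      rw [Fin.forall_fin_two]
      simp only [spongePos, q', Matrix.cons_val_zero, Matrix.cons_val_one]
      constructor <;> split_ifs <;> omega
    have hadj : (wordGraph E).Adj [q'] [⟨(⟨a, ha⟩, ⟨b, hb⟩), Nat.even_iff.2 hab⟩] := by
      refine ⟨fun hh => ?_, rfl, fun c => ?_⟩
      · have := congrArg (fun t : SpongeIndex l => (t.1.1 : ℕ)) (List.singleton_injective hh)
        simp only [q'] at this
        split_ifs at this <;> omega
      · rw [sponge_cell_singleton h, sponge_cell_singleton h, abs_le]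
        revert c
        rw [Fin.forall_fin_two]
        simp only [spongePos, q', Matrix.cons_val_zero, Matrix.cons_val_one]
        constructor <;> split_ifs <;> omega
    refine mem_neighborhood_trans ?_ (mem_neighborhood_one hadj)
    by_cases hc' : q' = spongeCenter l
    · rw [hc']; exact mem_neighborhood_self _ _
    · exact ih q' hq' hc'

end Coding

theorem sponge_hasInternalScalingDimension {l : ℕ} (hl : 1 ≤ l)
    {M : Set (EuclideanSpace ℝ (Fin 2))} (hM : (spongeSystem l).IsSelfSimilarSet M) :
    HasInternalScalingDimension ((spongeSystem l).adjointGraph (spongeCenter l) M)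
      (Real.log (2 * (l : ℝ) ^ 2 + 2 * (l : ℝ) + 1) / Real.log (2 * (l : ℝ) + 1)) := by
  obtain ⟨E, hE⟩ := exists_isCoding_spongeSystem hl hM
  have hball : ∀ q, [q] ∈ neighborhood (wordGraph E) l [spongeCenter l] := fun q =>
    sponge_mem_neighborhood hl hE l q fun a => by
      have := spongePos_bounds q a
      rw [abs_le]
      constructor <;> linarith [this.1, this.2]
  have := hE.hasInternalScalingDimension rfl (sponge_exists_adj_append hE) (fun q _ => hball q)
    fun q => by
      obtain ⟨w, -⟩ := mem_neighborhood_iff.1 (hball q)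
      exact ⟨w⟩
  rw [card_spongeIndex] at this
  exact_mod_cast this

/-! ### The limit of the sponge dimensions -/

theorem tendsto_spongeDimension :
    Tendsto (fun l : ℕ => Real.log (2 * (l : ℝ) ^ 2 + 2 * (l : ℝ) + 1) /
      Real.log (2 * (l : ℝ) + 1)) atTop (𝓝 2) := by
  have hlog : Tendsto (fun l : ℕ => Real.log (2 * (l : ℝ) + 1)) atTop atTop :=
    Real.tendsto_log_atTop.comp (tendsto_atTop_add_const_right _ _
      (tendsto_natCast_atTop_atTop.const_mul_atTop two_pos))
  rw [tendsto_iff_norm_sub_tendsto_zero]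
  refine squeeze_zero' (Eventually.of_forall fun _ => norm_nonneg _) ?_
    (hlog.const_div_atTop (Real.log 2))
  filter_upwards [hlog.eventually_gt_atTop 0] with l hl
  have hl0 : (0 : ℝ) ≤ l := Nat.cast_nonneg l
  have h1 : Real.log (2 * (l : ℝ) ^ 2 + 2 * l + 1) ≤ 2 * Real.log (2 * (l : ℝ) + 1) := by
    rw [← Nat.cast_two (R := ℝ), ← Real.log_pow]
    exact Real.log_le_log (by positivity) (by push_cast; nlinarith)
  -- The pattern fills more than half of the square, so the dimension differs from 2 by at most `ln
  -- 2 / ln (2l+1)`.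
  have h2 : 2 * Real.log (2 * (l : ℝ) + 1) ≤
      Real.log 2 + Real.log (2 * (l : ℝ) ^ 2 + 2 * l + 1) := by
    rw [← Real.log_mul (by norm_num) (by positivity)]
    have h3 : ((2 : ℕ) : ℝ) * Real.log (2 * (l : ℝ) + 1) ≤
        Real.log (2 * (2 * (l : ℝ) ^ 2 + 2 * l + 1)) := by
      rw [← Real.log_pow]
      exact Real.log_le_log (by positivity) (by nlinarith)
    exact_mod_cast h3
  have : Real.log (2 * (l : ℝ) ^ 2 + 2 * l + 1) / Real.log (2 * (l : ℝ) + 1) - 2 =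
      (Real.log (2 * (l : ℝ) ^ 2 + 2 * l + 1) - 2 * Real.log (2 * (l : ℝ) + 1)) /
        Real.log (2 * (l : ℝ) + 1) := by field_simp
  rw [this, norm_div, Real.norm_of_nonneg hl.le, Real.norm_eq_abs]
  have hlog2 : 0 ≤ Real.log 2 := Real.log_nonneg (by norm_num)
  exact div_le_div_of_nonneg_right (abs_le.2 ⟨by linarith, by linarith⟩) hl.le

end SelfSimilarGraph

end

theorem mainTheorem7 :
    (∀ (p : ℕ) (ι : Type*) [Finite ι] (S : SelfSimilarGraph.SimilaritySystem p ι)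
      (M : Set (EuclideanSpace ℝ (Fin p))) (r : ℕ) (x₀ : S.StepNode M 1) (i₀ : ι),
      0 < S.ratio → S.ratio < 1 → 2 * (r : ℝ) + 1 = 1 / S.ratio →
      S.IsSelfSimilarSet M → S.FitsLattice → S.BondsAreInherited M →
      S.IsNodeOf M x₀ i₀ →
      (∀ v : S.StepNode M 1, S.IsMarginal M v → (S.stepGraph M 1).edist x₀ v = (r : ℕ∞)) →
      (S.adjointGraph i₀ M).Connected →
      ∃ D : ℝ, SelfSimilarGraph.HasInternalScalingDimension (S.adjointGraph i₀ M) D ∧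
        SelfSimilarGraph.HasBoxDimension M D) ∧
    (∀ l : ℕ, 1 ≤ l →
      (SelfSimilarGraph.spongeSystem l).IsSelfSimilarSet
        (SelfSimilarGraph.spongeSystem l).generatedSet ∧
      ∀ M : Set (EuclideanSpace ℝ (Fin 2)),
        (SelfSimilarGraph.spongeSystem l).IsSelfSimilarSet M →
        SelfSimilarGraph.HasInternalScalingDimension
          ((SelfSimilarGraph.spongeSystem l).adjointGraph (SelfSimilarGraph.spongeCenter l) M)
          (Real.log (2 * (l : ℝ) ^ 2 + 2 * (l : ℝ) + 1) / Real.log (2 * (l : ℝ) + 1))) ∧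
    Filter.Tendsto
      (fun l : ℕ => Real.log (2 * (l : ℝ) ^ 2 + 2 * (l : ℝ) + 1) / Real.log (2 * (l : ℝ) + 1))
      Filter.atTop (nhds 2) := by
  refine ⟨?_, fun l hl => ⟨SelfSimilarGraph.spongeSystem_isSelfSimilarSet_generatedSet l,
    fun M hM => SelfSimilarGraph.sponge_hasInternalScalingDimension hl hM⟩,
    SelfSimilarGraph.tendsto_spongeDimension⟩
  intro p ι _ S M r x₀ i₀ _ hc1 hr hM hfit hb hx₀ hmarg hconn
  exact SelfSimilarGraph.SimilaritySystem.exists_dimension hc1 hr hM hfit hb hx₀ hmarg hconn
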